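/- **Setting.** Let $v,w:[0,\infty)\to(0,\infty)$ be measurable weights with $\int_0^\infty \frac{du}{v(u)}<\infty$, $\int_0^\infty\frac{1+u^2}{w(u)}\,du<\infty$ and $\int_0^\infty\int_0^s \frac{v(u)}{w(s)}\,du\,ds<\infty$. Let $F=F_v^1$ be the space of locally absolutely continuous $x:[0,\infty)\to\mathbb R$ with $x(\infty)=0$ and $\|x\|_F^2=\int_0^\infty x'(u)^2v(u)\,du<\infty$, and let $F_w^2$ be the space of differentiable $x:[0,\infty)\to\mathbb R$ with $x'$ locally absolutely continuous, $x(\infty)=x'(\infty)=0$ and $\|x\|_{F_w^2}^2=\int_0^\infty x''(u)^2w(u)\,du<\infty$; then $F_w^2\subset F$ continuously and $\delta_s:x\mapsto x(s)$ belongs to $F^*$ for every $s\ge0$. For a closed interval $A\subset[0,\infty)$ put $\mathcal T_A=\overline{\operatorname{span}}\{\delta_s:s\in A\}\subset F^*$. Let $H$ be a real separable Hilbert space, $W$ a cylindrical $H$-valued Wiener process on a complete probability space $(\Omega,\mathcal F,\mathbb Q)$, and $(\mathcal F_t)_{t\ge 0}$ the augmented filtration generated by $W$. All processes are measurable and adapted,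 and $\int\alpha_s\,dW_s$ is the Itô integral of square-integrable integrands $\alpha$ with Hilbert–Schmidt values. For an operator $A:H\to F_w^2\subset F$ let $A^*:F^*\to H^*$ be its adjoint. The discounted bond price curve $\tilde P_t\in F_w^2$ satisfies, with $\tilde P_0\in F_w^2$ deterministic, $$d\tilde P_t=\sigma_t\,dW_t,\qquad \sigma_t^*\delta_s=0\ \ (s\le t),\qquad \tilde P_t(s)>0\ \ (s\ge0),$$ where $\sigma$ takes values in the Hilbert–Schmidt operators $H\to F_w^2$, and for all $t$ $$\mathbb E\int_0^t\Big(\frac{|\tilde P_s'(s)|\,\|\tilde P_s\|_{F_w^2}}{\tilde P_s(s)^2}+\Big(1+\frac1{\tilde P_s(s)^2}\Big)\|\sigma_s\|_{\mathcal L_{HS}(H,F_w^2)}^2\Big)ds<\infty .$$ The bank account is $B_t=1/\tilde P_t(t)$ and the bond price curve is $P_t=\tilde P_t/\tilde P_t(t)$, so that $$dP_t=-\frac{\tilde P_t'(t)}{\tilde P_t(t)^2}\tilde P_t\,dt+\frac1{\tilde P_t(t)}\sigma_t\,dW_t .$$ For $dX_t=b_t\,dt+A_t\,dW_t$ one writes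 $\langle\varphi_t,dX_t\rangle_F=\langle\varphi_t,b_t\rangle_F\,dt+A_t^*\varphi_t\,dW_t$, the first integral being required to converge absolutely almost surely and $A^*\varphi$ to be square-integrable. Let $T\ge0$. A *strategy* is an $F^*$-valued process $(\varphi_t)_{t\in[0,T]}$ with $\varphi_t\in\mathcal T_{[t,\infty)}$ for almost every $(t,\omega)$. It is *self-financing* if $d\langle\varphi_t,P_t\rangle_F=\langle\varphi_t,dP_t\rangle_F$ on $[0,T]$. Let $\xi$ be an $\mathcal F_T$-measurable real random variable and $\tilde\xi=\xi/B_T$. The strategy is *pre-hedging* for $\xi$ if $\tilde\xi$ is integrable and $\tilde\xi=\mathbb E\{\tilde\xi\}+\int_0^T\langle\varphi_s,d\tilde P_s\rangle_F$. A *hedging strategy* for $\xi$ is a self-financing pre-hedging strategy that replicates the payout: $\langle\varphi_T,P_T\rangle_F=\xi$ almost surely. **Proposition 3.7.** Suppose that, for almost all $(t,\omega)\in[0,T]\times\Omega$, $$\ker(\sigma_t^*)=\mathcal T_{[0,t]}\subset F^* .$$ If $\varphi^1$ and $\varphi^2$ are hedging strategies for the same claim $\xi$, then $\varphi^1_t=\varphi^2_t$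 for almost all $(t,\omega)\in[0,T]\times\Omega$. -/

import Mathlib

open MeasureTheory ProbabilityTheory Filter Topology Set
open scoped NNReal ENNReal

namespace BondMarket

noncomputable section

/-! ### Weighted Sobolev spaces on the half-line -/

/-- A positive measurable weight on `[0, ∞)`. -/
structure Weight where
  toFun : ℝ≥0 → ℝ
  measurable_toFun : Measurable toFun
  pos : ∀ u, 0 < toFun u

/-- The measure `v(u) du` on `(0, ∞)`. -/
def Weight.measure (v : Weight) : Measure ℝ :=
  (volume.restrict (Ioi 0)).withDensity fun u => ENNReal.ofReal (v.toFun u.toNNReal)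

/-- A function on `[0, ∞)` seen as a function on `ℝ` (constant on the negative half-line); only its
values on `[0, ∞)` matter below. -/
def halfExt (x : ℝ≥0 → ℝ) : ℝ → ℝ := fun u => x u.toNNReal

/-- The derivative of a function on `[0, ∞)` (one-sided at `0`). -/
def rderiv (x : ℝ≥0 → ℝ) : ℝ≥0 → ℝ := fun u => derivWithin (halfExt x) (Ici 0) u

/-- Membership in the space of locally absolutely continuous functions `x` on `[0, ∞)` with
`x(∞) = 0` and `∫₀^∞ x'(u)² v(u) du < ∞`. -/
structure MemF1 (v : Weight) (x : ℝ≥0 → ℝ) : Prop where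
  ac : ∀ b : ℝ≥0, AbsolutelyContinuousOnInterval (halfExt x) 0 b
  lim : Tendsto x atTop (𝓝 0)
  memLp : MemLp (deriv (halfExt x)) 2 v.measure

/-- Membership in the space of differentiable functions `x` on `[0, ∞)` with `x'` locally absolutely
continuous, `x(∞) = x'(∞) = 0` and `∫₀^∞ x''(u)² w(u) du < ∞`. -/
structure MemF2 (w : Weight) (x : ℝ≥0 → ℝ) : Prop where
  diff : DifferentiableOn ℝ (halfExt x) (Ici 0)
  lim : Tendsto x atTop (𝓝 0)
  memF1 : MemF1 w (rderiv x)

theorem halfExt_add (x y : ℝ≥0 → ℝ) : halfExt (x + y) = halfExt x + halfExt y := rfl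

theorem halfExt_smul (c : ℝ) (x : ℝ≥0 → ℝ) : halfExt (c • x) = c • halfExt x := rfl

theorem measure_ac (v : Weight) : v.measure ≪ volume.restrict (Ioi 0) :=
  withDensity_absolutelyContinuous _ _

theorem measure_ac' (v : Weight) : volume.restrict (Ioi 0) ≪ v.measure := by
  refine withDensity_absolutelyContinuous' ?_ ?_
  · exact (v.measurable_toFun.comp measurable_real_toNNReal).ennreal_ofReal.aemeasurable
  · exact ae_of_all _ fun u => by simpa using v.pos _

theorem lintegral_measure (v : Weight) {f : ℝ → ℝ≥0∞} (hf : Measurable f) :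
    ∫⁻ u, f u ∂v.measure
      = ∫⁻ u in Ioi (0 : ℝ), ENNReal.ofReal (v.toFun u.toNNReal) * f u := by
  have hV : Measurable fun u : ℝ => ENNReal.ofReal (v.toFun u.toNNReal) :=
    (v.measurable_toFun.comp measurable_real_toNNReal).ennreal_ofReal
  rw [Weight.measure, lintegral_withDensity_eq_lintegral_mul _ hV hf]
  rfl

theorem eLpNorm_sq (v : Weight) {f : ℝ → ℝ} (hf : Measurable f) :
    eLpNorm f 2 v.measure ^ 2
      = ∫⁻ u in Ioi (0 : ℝ), ENNReal.ofReal (v.toFun u.toNNReal) * ‖f u‖ₑ ^ 2 := by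
  rw [eLpNorm_eq_lintegral_rpow_enorm_toReal (by norm_num) (by norm_num), ← ENNReal.rpow_natCast,
    ← ENNReal.rpow_mul]
  norm_num
  exact lintegral_measure v (by fun_prop)

theorem MemF1.ae_diff {v : Weight} {x : ℝ≥0 → ℝ} (hx : MemF1 v x) :
    ∀ᵐ u ∂(volume.restrict (Ioi (0 : ℝ))), DifferentiableAt ℝ (halfExt x) u := by
  rw [ae_restrict_iff' measurableSet_Ioi]
  have h : ∀ n : ℕ, ∀ᵐ u : ℝ, u ∈ uIcc (0 : ℝ) n → DifferentiableAt ℝ (halfExt x) u := fun n => by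
    simpa using (hx.ac n).ae_differentiableAt
  filter_upwards [ae_all_iff.2 h] with u hu hu0
  obtain ⟨n, hn⟩ := exists_nat_ge u
  exact hu n (by rw [uIcc_of_le (by positivity)]; exact ⟨le_of_lt hu0, hn⟩)

theorem MemF1.deriv_add {v : Weight} {x y : ℝ≥0 → ℝ} (hx : MemF1 v x) (hy : MemF1 v y) :
    deriv (halfExt (x + y)) =ᵐ[v.measure] deriv (halfExt x) + deriv (halfExt y) := by
  apply (measure_ac v).ae_le
  filter_upwards [hx.ae_diff, hy.ae_diff] with u h1 h2
  rw [halfExt_add]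
  exact _root_.deriv_add h1 h2

theorem MemF1.deriv_smul {v : Weight} {x : ℝ≥0 → ℝ} (c : ℝ) (hx : MemF1 v x) :
    deriv (halfExt (c • x)) =ᵐ[v.measure] c • deriv (halfExt x) := by
  apply (measure_ac v).ae_le
  filter_upwards [hx.ae_diff] with u h1
  rw [halfExt_smul]
  exact deriv_const_smul c h1

/-- The functions in the first-order space, as a vector space of functions. -/
def F1sub (v : Weight) : Submodule ℝ (ℝ≥0 → ℝ) where
  carrier := {x | MemF1 v x}
  zero_mem' := by
    have h0 : halfExt (0 : ℝ≥0 → ℝ) = fun _ => 0 := rfl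
    refine ⟨fun b => ?_, tendsto_const_nhds, ?_⟩
    · rw [h0]
      exact (LipschitzWith.const (0 : ℝ)).lipschitzOnWith.absolutelyContinuousOnInterval
    · rw [h0, deriv_const']; exact MemLp.zero
  add_mem' {x y} hx hy :=
    ⟨fun b => (hx.ac b).add (hy.ac b), by have := hx.lim.add hy.lim; rwa [add_zero] at this,
      (memLp_congr_ae (hx.deriv_add hy)).2 (hx.memLp.add hy.memLp)⟩
  smul_mem' c x hx :=
    ⟨fun b => (hx.ac b).const_mul c, by have := hx.lim.const_mul c; rwa [mul_zero] at this,
      (memLp_congr_ae (hx.deriv_smul c)).2 (hx.memLp.const_smul c)⟩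

/-- The weighted Sobolev space `F_v^1`. -/
def F1 (v : Weight) : Type := F1sub v

instance (v : Weight) : AddCommGroup (F1 v) := inferInstanceAs (AddCommGroup (F1sub v))
instance (v : Weight) : Module ℝ (F1 v) := inferInstanceAs (Module ℝ (F1sub v))
instance (v : Weight) : CoeFun (F1 v) fun _ => ℝ≥0 → ℝ := ⟨fun x => x.1⟩

/-- The derivative as a linear map from `F_v^1` to `L²(v(u) du)`. -/
def F1.D (v : Weight) : F1 v →ₗ[ℝ] Lp ℝ 2 v.measure where
  toFun x := x.2.memLp.toLp _
  map_add' x y := by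
    rw [← MemLp.toLp_add, MemLp.toLp_eq_toLp_iff]
    exact MemF1.deriv_add x.2 y.2
  map_smul' c x := by
    rw [RingHom.id_apply, ← MemLp.toLp_const_smul, MemLp.toLp_eq_toLp_iff]
    exact MemF1.deriv_smul c x.2

/-- Pointwise bound of an element of `F_v^1` through its derivative. -/
theorem MemF1.enorm_sq_le {v : Weight} {x : ℝ≥0 → ℝ} (hx : MemF1 v x) (a : ℝ≥0) :
    ‖x a‖ₑ ^ 2 ≤ (∫⁻ u in Ioi (a : ℝ), ENNReal.ofReal (v.toFun u.toNNReal)⁻¹)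
      * eLpNorm (deriv (halfExt x)) 2 v.measure ^ 2 := by
  set f := deriv (halfExt x) with hf
  have hfm : Measurable f := measurable_deriv _
  -- the fundamental theorem of calculus
  have h1 : ‖x a‖ₑ ≤ ∫⁻ u in Ioi (a : ℝ), ‖f u‖ₑ := by
    have hb : ∀ b : ℝ≥0, a ≤ b → ‖x b - x a‖ₑ ≤ ∫⁻ u in Ioi (a : ℝ), ‖f u‖ₑ := by
      intro b hab
      have hab' : (a : ℝ) ≤ b := hab
      have hac : AbsolutelyContinuousOnInterval (halfExt x) a b := by
        refine (hx.ac b).mono ?_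
        rw [uIcc_of_le hab', uIcc_of_le (NNReal.coe_nonneg b)]
        exact Icc_subset_Icc_left a.2
      have := hac.integral_deriv_eq_sub
      simp only [halfExt, Real.toNNReal_coe] at this
      rw [← this, intervalIntegral.integral_of_le hab']
      refine (enorm_integral_le_lintegral_enorm _).trans ?_
      exact lintegral_mono_set Ioc_subset_Ioi_self
    have ht : Tendsto (fun b : ℝ≥0 => ‖x b - x a‖ₑ) atTop (𝓝 ‖0 - x a‖ₑ) :=
      (hx.lim.sub_const _).enorm
    have := le_of_tendsto ht (eventually_atTop.2 ⟨a, hb⟩)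
    simpa using this
  -- the Cauchy-Schwarz inequality
  set V : ℝ → ℝ≥0∞ := fun u => ENNReal.ofReal (v.toFun u.toNNReal) with hV
  have hVm : Measurable V :=
    (v.measurable_toFun.comp measurable_real_toNNReal).ennreal_ofReal
  have hVinv : ∀ u : ℝ, ENNReal.ofReal (v.toFun u.toNNReal)⁻¹ = (V u)⁻¹ := fun u =>
    ENNReal.ofReal_inv_of_pos (v.pos _)
  have hV0 : ∀ u, V u ≠ 0 := fun u => by simpa [hV] using v.pos _
  have hVt : ∀ u, V u ≠ ∞ := fun u => ENNReal.ofReal_ne_top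
  have h2 : ∫⁻ u in Ioi (a : ℝ), ‖f u‖ₑ ≤
      (∫⁻ u in Ioi (a : ℝ), ((V u)⁻¹ ^ (1 / 2 : ℝ)) ^ (2 : ℝ)) ^ (1 / (2 : ℝ)) *
      (∫⁻ u in Ioi (a : ℝ), (V u ^ (1 / 2 : ℝ) * ‖f u‖ₑ) ^ (2 : ℝ)) ^ (1 / (2 : ℝ)) := by
    refine le_trans (le_of_eq ?_) (ENNReal.lintegral_mul_le_Lp_mul_Lq _
      Real.HolderConjugate.two_two (by fun_prop) (by fun_prop))
    refine lintegral_congr fun u => ?_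
    rw [Pi.mul_apply, ← mul_assoc, ← ENNReal.mul_rpow_of_nonneg _ _ (by norm_num),
      ENNReal.inv_mul_cancel (hV0 u) (hVt u)]
    simp
  have h3 : ∀ z : ℝ≥0∞, (z ^ (1 / 2 : ℝ)) ^ (2 : ℝ) = z := fun z => by
    rw [← ENNReal.rpow_mul]; norm_num
  have h4 : eLpNorm f 2 v.measure ^ 2 = ∫⁻ u in Ioi (0 : ℝ), V u * ‖f u‖ₑ ^ 2 :=
    eLpNorm_sq v hfm
  calc ‖x a‖ₑ ^ 2 ≤ (∫⁻ u in Ioi (a : ℝ), ‖f u‖ₑ) ^ 2 := by gcongr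
    _ ≤ ((∫⁻ u in Ioi (a : ℝ), ((V u)⁻¹ ^ (1 / 2 : ℝ)) ^ (2 : ℝ)) ^ (1 / (2 : ℝ)) *
      (∫⁻ u in Ioi (a : ℝ), (V u ^ (1 / 2 : ℝ) * ‖f u‖ₑ) ^ (2 : ℝ)) ^ (1 / (2 : ℝ))) ^ 2 :=
      pow_le_pow_left' h2 2
    _ = (∫⁻ u in Ioi (a : ℝ), (V u)⁻¹) * ∫⁻ u in Ioi (a : ℝ), V u * ‖f u‖ₑ ^ 2 := by
      rw [mul_pow, ← ENNReal.rpow_two, ← ENNReal.rpow_two, h3, h3]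
      simp only [h3, ENNReal.mul_rpow_of_nonneg _ _ (zero_le_two (α := ℝ)),
        ENNReal.rpow_two]
    _ ≤ (∫⁻ u in Ioi (a : ℝ), ENNReal.ofReal (v.toFun u.toNNReal)⁻¹)
      * eLpNorm f 2 v.measure ^ 2 := by
      simp only [hVinv, h4]
      refine mul_le_mul' le_rfl (lintegral_mono_set (Ioi_subset_Ioi a.2))

theorem F1.enorm_D (v : Weight) (x : F1 v) :
    ‖F1.D v x‖ₑ = eLpNorm (deriv (halfExt x)) 2 v.measure :=
  Lp.enorm_toLp x.2.memLp

theorem F1.D_injective (v : Weight) : Function.Injective (F1.D v) := by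
  rw [injective_iff_map_eq_zero]
  intro x hx
  have h0 : eLpNorm (deriv (halfExt x)) 2 v.measure = 0 := by
    rw [← F1.enorm_D, hx, enorm_zero]
  refine Subtype.ext (funext fun a => ?_)
  have h := x.2.enorm_sq_le a
  rw [h0] at h
  have h' : x.1 a = 0 := by simpa using h
  exact h'

/-- The norm of `F_v^1` is the norm of the derivative in `L²(v(u) du)`. -/
instance (v : Weight) : NormedAddCommGroup (F1 v) :=
  NormedAddCommGroup.induced (F1 v) (Lp ℝ 2 v.measure) (F1.D v) (F1.D_injective v)

instance (v : Weight) : InnerProductSpace ℝ (F1 v) :=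
  InnerProductSpace.induced (F1.D v)

theorem F1.enorm_eq (v : Weight) (x : F1 v) :
    ‖x‖ₑ = eLpNorm (deriv (halfExt x)) 2 v.measure :=
  F1.enorm_D v x

theorem rderiv_add {x y : ℝ≥0 → ℝ} (hx : DifferentiableOn ℝ (halfExt x) (Ici 0))
    (hy : DifferentiableOn ℝ (halfExt y) (Ici 0)) : rderiv (x + y) = rderiv x + rderiv y :=
  funext fun u => derivWithin_add (hx u u.2) (hy u u.2)

theorem rderiv_smul {x : ℝ≥0 → ℝ} (c : ℝ) (hx : DifferentiableOn ℝ (halfExt x) (Ici 0)) :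
    rderiv (c • x) = c • rderiv x :=
  funext fun u => derivWithin_const_smul c (hx u u.2)

/-- The functions in the second-order space, as a vector space of functions. -/
def F2sub (w : Weight) : Submodule ℝ (ℝ≥0 → ℝ) where
  carrier := {x | MemF2 w x}
  zero_mem' := by
    have h0 : halfExt (0 : ℝ≥0 → ℝ) = fun _ => 0 := rfl
    refine ⟨?_, tendsto_const_nhds, ?_⟩
    · rw [h0]; exact differentiableOn_const 0
    · have : rderiv (0 : ℝ≥0 → ℝ) = 0 := by
        funext u; simp [rderiv, h0]
      rw [this]; exact (F1sub w).zero_mem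
  add_mem' {x y} hx hy :=
    ⟨hx.diff.add hy.diff, by have := hx.lim.add hy.lim; rwa [add_zero] at this, by
      rw [rderiv_add hx.diff hy.diff]; exact (F1sub w).add_mem hx.memF1 hy.memF1⟩
  smul_mem' c x hx :=
    ⟨hx.diff.const_smul c, by have := hx.lim.const_mul c; rwa [mul_zero] at this, by
      rw [rderiv_smul c hx.diff]; exact (F1sub w).smul_mem c hx.memF1⟩

/-- The weighted Sobolev space `F_w^2`. -/
def F2 (w : Weight) : Type := F2sub w

instance (w : Weight) : AddCommGroup (F2 w) := inferInstanceAs (AddCommGroup (F2sub w))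
instance (w : Weight) : Module ℝ (F2 w) := inferInstanceAs (Module ℝ (F2sub w))
instance (w : Weight) : CoeFun (F2 w) fun _ => ℝ≥0 → ℝ := ⟨fun x => x.1⟩

/-- The derivative as a linear map from `F_w^2` to `F_w^1`. -/
def F2.D (w : Weight) : F2 w →ₗ[ℝ] F1 w where
  toFun x := ⟨rderiv x.1, x.2.memF1⟩
  map_add' x y := Subtype.ext (rderiv_add x.2.diff y.2.diff)
  map_smul' c x := Subtype.ext (rderiv_smul c x.2.diff)

theorem halfExt_coe (x : ℝ≥0 → ℝ) (u : ℝ≥0) : halfExt x u = x u := by simp [halfExt]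

/-- Where the derivative is bounded by `C`, the function is `C`-Lipschitz. -/
theorem MemF2.lipschitz {w : Weight} {x : ℝ≥0 → ℝ} (hx : MemF2 w x) (b : ℝ) (C : ℝ≥0)
    (hC : ∀ u ∈ Icc 0 b, ‖rderiv x u.toNNReal‖₊ ≤ C) :
    LipschitzOnWith C (halfExt x) (Icc 0 b) := by
  refine Convex.lipschitzOnWith_of_nnnorm_hasDerivWithin_le (convex_Icc 0 b)
    (f' := fun u => rderiv x u.toNNReal) (fun u hu => ?_) hC
  have h := (hx.diff u hu.1).hasDerivWithinAt
  have h' : rderiv x u.toNNReal = derivWithin (halfExt x) (Ici 0) u := by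
    simp [rderiv, Real.coe_toNNReal u hu.1]
  rw [h']
  exact h.mono Icc_subset_Ici_self

theorem F2.D_injective (w : Weight) : Function.Injective (F2.D w) := by
  rw [injective_iff_map_eq_zero]
  intro x hx
  have h0 : ∀ u, rderiv x.1 u = 0 := fun u => congrFun (congrArg Subtype.val hx) u
  have hc : ∀ a : ℝ≥0, x.1 a = x.1 0 := fun a => by
    have h := x.2.lipschitz a 0 (fun u _ => by simp [h0])
    have h2 := h.dist_le_mul (a : ℝ) ⟨a.2, le_rfl⟩ ((0 : ℝ≥0) : ℝ) ⟨le_rfl, a.2⟩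
    rw [halfExt_coe, halfExt_coe] at h2
    simpa using h2
  have hlim : Tendsto x.1 atTop (𝓝 (x.1 0)) := by
    rw [show x.1 = fun _ => x.1 0 from funext hc]; exact tendsto_const_nhds
  refine Subtype.ext (funext fun a => ?_)
  rw [hc a]
  exact tendsto_nhds_unique hlim x.2.lim

/-- The norm of `F_w^2` is the norm of the second derivative in `L²(w(u) du)`. -/
instance (w : Weight) : NormedAddCommGroup (F2 w) :=
  NormedAddCommGroup.induced (F2 w) (F1 w) (F2.D w) (F2.D_injective w)

instance (w : Weight) : InnerProductSpace ℝ (F2 w) :=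
  InnerProductSpace.induced (F2.D w)

/-- A pair of weights satisfying the integrability conditions under which point evaluations are
continuous on `F_v^1`, point evaluations and point derivatives are continuous on `F_w^2`, and `F_w^2`
is continuously included in `F_v^1`. -/
structure WeightPair where
  v : Weight
  w : Weight
  finite_v : ∫⁻ u in Ioi (0 : ℝ), ENNReal.ofReal (v.toFun u.toNNReal)⁻¹ < ∞
  finite_w : ∫⁻ u in Ioi (0 : ℝ), ENNReal.ofReal ((1 + u ^ 2) * (w.toFun u.toNNReal)⁻¹) < ∞
  finite_vw : ∫⁻ s in Ioi (0 : ℝ), ∫⁻ u in Ioc (0 : ℝ) s,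
    ENNReal.ofReal (v.toFun u.toNNReal / w.toFun s.toNNReal) < ∞

namespace WeightPair

variable (p : WeightPair)

/-- The space `F = F_v^1`, whose dual contains the portfolios. -/
abbrev F : Type := F1 p.v

/-- The dual `F^*`. -/
abbrev Fdual : Type := F1 p.v →L[ℝ] ℝ

theorem enorm_le_of_sq_le {a b : ℝ} {K : ℝ≥0∞} (hK : K < ∞) (h : ‖a‖ₑ ^ 2 ≤ K * ‖b‖ₑ ^ 2) :
    ‖a‖ ≤ √K.toReal * ‖b‖ := by
  have h' := ENNReal.toReal_mono (ENNReal.mul_ne_top hK.ne (by simp)) h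
  simp only [ENNReal.toReal_pow, toReal_enorm, ENNReal.toReal_mul] at h'
  have := Real.sqrt_le_sqrt h'
  rwa [Real.sqrt_sq (norm_nonneg _), Real.sqrt_mul ENNReal.toReal_nonneg,
    Real.sqrt_sq (norm_nonneg _)] at this

/-- The point evaluation `δ_s` on `F_v^1`. -/
def δ (s : ℝ≥0) : p.Fdual :=
  LinearMap.mkContinuous
    { toFun := fun x : F1 p.v => x s
      map_add' := fun _ _ => rfl
      map_smul' := fun _ _ => rfl }
    (√(∫⁻ u in Ioi (0 : ℝ), ENNReal.ofReal (p.v.toFun u.toNNReal)⁻¹).toReal)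
    (fun x => by
      have h : ‖x s‖ₑ ^ 2 ≤ (∫⁻ u in Ioi (0 : ℝ), ENNReal.ofReal (p.v.toFun u.toNNReal)⁻¹)
          * ‖‖x‖‖ₑ ^ 2 := by
        rw [enorm_norm, F1.enorm_eq]
        exact (x.2.enorm_sq_le s).trans
          (mul_le_mul' (lintegral_mono_set (Ioi_subset_Ioi s.2)) le_rfl)
      have h' := enorm_le_of_sq_le p.finite_v h
      rw [norm_norm] at h'
      exact h')

theorem δ_apply (s : ℝ≥0) (x : p.F) : p.δ s x = x s := rfl

theorem deriv_halfExt_eq {x : ℝ≥0 → ℝ} {u : ℝ} (hu : 0 < u) :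
    deriv (halfExt x) u = rderiv x u.toNNReal := by
  rw [rderiv, Real.coe_toNNReal u hu.le, derivWithin_of_mem_nhds (Ici_mem_nhds hu)]

theorem eLpNorm_deriv_sq_le (x : F2 p.w) :
    eLpNorm (deriv (halfExt x.1)) 2 p.v.measure ^ 2 ≤
      (∫⁻ s in Ioi (0 : ℝ), ∫⁻ u in Ioc (0 : ℝ) s,
        ENNReal.ofReal (p.v.toFun u.toNNReal / p.w.toFun s.toNNReal)) * ‖x‖ₑ ^ 2 := by
  set V : ℝ → ℝ≥0∞ := fun u => ENNReal.ofReal (p.v.toFun u.toNNReal)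
  set W : ℝ → ℝ≥0∞ := fun u => ENNReal.ofReal (p.w.toFun u.toNNReal)⁻¹
  have hVm : Measurable V :=
    (p.v.measurable_toFun.comp measurable_real_toNNReal).ennreal_ofReal
  have hWm : Measurable W :=
    (p.w.measurable_toFun.comp measurable_real_toNNReal).inv.ennreal_ofReal
  have hx : eLpNorm (deriv (halfExt (rderiv x.1))) 2 p.w.measure = ‖x‖ₑ :=
    (F1.enorm_eq p.w (F2.D p.w x)).symm
  have hk : Measurable fun q : ℝ × ℝ => {q : ℝ × ℝ | q.1 < q.2}.indicator
      (fun q => V q.1 * W q.2) q :=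
    ((hVm.comp measurable_fst).mul (hWm.comp measurable_snd)).indicator
      (measurableSet_lt measurable_fst measurable_snd)
  rw [eLpNorm_sq p.v (measurable_deriv _)]
  calc ∫⁻ u in Ioi (0 : ℝ), V u * ‖deriv (halfExt x.1) u‖ₑ ^ 2
      ≤ ∫⁻ u in Ioi (0 : ℝ), (∫⁻ s in Ioi (0 : ℝ), {q : ℝ × ℝ | q.1 < q.2}.indicator
          (fun q => V q.1 * W q.2) (u, s)) * ‖x‖ₑ ^ 2 := by
        refine setLIntegral_mono' measurableSet_Ioi fun u hu => ?_
        rw [deriv_halfExt_eq hu]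
        have h := x.2.memF1.enorm_sq_le u.toNNReal
        rw [hx, Real.coe_toNNReal u (le_of_lt hu)] at h
        have h2 : ∫⁻ s in Ioi (0 : ℝ), {q : ℝ × ℝ | q.1 < q.2}.indicator
            (fun q => V q.1 * W q.2) (u, s) = V u * ∫⁻ s in Ioi u, W s := by
          have h3 : (fun s : ℝ => {q : ℝ × ℝ | q.1 < q.2}.indicator
              (fun q => V q.1 * W q.2) (u, s)) = (Ioi u).indicator fun s => V u * W s := by
            funext s
            by_cases hs : u < s <;> simp [Set.indicator, hs]
          rw [h3, lintegral_indicator measurableSet_Ioi, Measure.restrict_restrict measurableSet_Ioi,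
            inter_eq_left.2 (Ioi_subset_Ioi (le_of_lt hu)), lintegral_const_mul _ hWm]
        rw [h2, mul_assoc]
        exact mul_le_mul' le_rfl h
    _ = (∫⁻ u in Ioi (0 : ℝ), ∫⁻ s in Ioi (0 : ℝ), {q : ℝ × ℝ | q.1 < q.2}.indicator
          (fun q => V q.1 * W q.2) (u, s)) * ‖x‖ₑ ^ 2 :=
        lintegral_mul_const _ hk.lintegral_prod_right'
    _ = (∫⁻ s in Ioi (0 : ℝ), ∫⁻ u in Ioi (0 : ℝ), {q : ℝ × ℝ | q.1 < q.2}.indicator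
          (fun q => V q.1 * W q.2) (u, s)) * ‖x‖ₑ ^ 2 := by
        rw [lintegral_lintegral_swap hk.aemeasurable]
    _ ≤ _ := by
        refine mul_le_mul' (lintegral_mono fun s => ?_) le_rfl
        rw [← Ioi_inter_Iic, inter_comm, ← Measure.restrict_restrict measurableSet_Iic,
          ← lintegral_indicator measurableSet_Iic]
        refine lintegral_mono fun u => ?_
        by_cases hs : u < s
        · rw [indicator_of_mem (show (u, s) ∈ {q : ℝ × ℝ | q.1 < q.2} from hs),
            indicator_of_mem (show u ∈ Iic s from hs.le), div_eq_mul_inv,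
            ENNReal.ofReal_mul (p.v.pos _).le]
        · rw [indicator_of_notMem (show (u, s) ∉ {q : ℝ × ℝ | q.1 < q.2} from hs)]
          exact zero_le

theorem memF1 (x : F2 p.w) : MemF1 p.v x.1 := by
  refine ⟨fun b => ?_, x.2.lim, (measurable_deriv _).aestronglyMeasurable, ?_⟩
  · obtain ⟨K, hK⟩ := (x.2.memF1.ac b).exists_bound
    rw [uIcc_of_le (NNReal.coe_nonneg b)] at hK
    have h := x.2.lipschitz b K.toNNReal fun u hu => by
      rw [← NNReal.coe_le_coe, coe_nnnorm]
      exact (hK u hu).trans (Real.le_coe_toNNReal K)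
    refine LipschitzOnWith.absolutelyContinuousOnInterval (K := K.toNNReal) ?_
    rwa [uIcc_of_le (NNReal.coe_nonneg b)]
  · have h := (p.eLpNorm_deriv_sq_le x).trans_lt
      (ENNReal.mul_lt_top p.finite_vw (ENNReal.pow_lt_top enorm_lt_top))
    by_contra hc
    rw [not_lt, top_le_iff] at hc
    rw [hc] at h
    simp at h

/-- The inclusion of `F_w^2` in `F_v^1`. -/
def incl : F2 p.w →L[ℝ] p.F :=
  LinearMap.mkContinuous
    { toFun := fun x => ⟨x.1, p.memF1 x⟩
      map_add' := fun _ _ => rfl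
      map_smul' := fun _ _ => rfl }
    (√(∫⁻ s in Ioi (0 : ℝ), ∫⁻ u in Ioc (0 : ℝ) s,
        ENNReal.ofReal (p.v.toFun u.toNNReal / p.w.toFun s.toNNReal)).toReal)
    (fun x => by
      let y : F1 p.v := ⟨x.1, p.memF1 x⟩
      have h : ‖y‖ₑ ^ 2 ≤ (∫⁻ s in Ioi (0 : ℝ), ∫⁻ u in Ioc (0 : ℝ) s,
          ENNReal.ofReal (p.v.toFun u.toNNReal / p.w.toFun s.toNNReal)) * ‖x‖ₑ ^ 2 := by
        rw [F1.enorm_eq]; exact p.eLpNorm_deriv_sq_le x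
      have h' := enorm_le_of_sq_le (a := ‖y‖) (b := ‖x‖) p.finite_vw
        (by rw [enorm_norm, enorm_norm]; exact h)
      rw [norm_norm, norm_norm] at h'
      exact h')

theorem incl_apply (x : F2 p.w) (s : ℝ≥0) : p.incl x s = x s := rfl

/-- The closed linear span of the point evaluations `δ_s`, `s ∈ A`, in `F^*`. -/
def closedSpan (A : Set ℝ≥0) : Submodule ℝ p.Fdual :=
  (Submodule.span ℝ (p.δ '' A)).topologicalClosure

/-- The Banach space adjoint `A^* : F^* → H^*` of an operator `A : H → F_w^2`, the latter space being
included in `F`. -/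
def adj {H : Type*} [NormedAddCommGroup H] [InnerProductSpace ℝ H] (A : H →L[ℝ] F2 p.w) :
    p.Fdual →L[ℝ] (H →L[ℝ] ℝ) :=
  ContinuousLinearMap.precomp ℝ (p.incl ∘L A)

end WeightPair

/-! ### The cylindrical Wiener process and the Itô integral -/

/-- Lebesgue measure on `[0, t]`, as a measure on `ℝ≥0`. -/
def leb (t : ℝ≥0) : Measure ℝ≥0 := (volume.restrict (Icc (0 : ℝ) t)).map Real.toNNReal

section Stochastic

variable {Ω : Type*} [mΩ : MeasurableSpace Ω]
variable {H : Type*} [NormedAddCommGroup H] [InnerProductSpace ℝ H]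
variable {G : Type*} [NormedAddCommGroup G] [InnerProductSpace ℝ G]

/-- `W t h` is the value at time `t` of a cylindrical `H`-valued Wiener process in the direction `h`:
the `W t h` are jointly Gaussian and centred, with `E[W_s(h) W_t(k)] = min(s, t) ⟨h, k⟩`, and the
paths `t ↦ W t h` are almost surely continuous. (Almost sure linearity in `h` follows.) -/
structure IsCylindricalWiener (W : ℝ≥0 → H → Ω → ℝ) (Q : Measure Ω) : Prop where
  measurable : ∀ t h, Measurable (W t h)
  gaussian : IsGaussianProcess (fun q : ℝ≥0 × H => W q.1 q.2) Q
  mean : ∀ t h, ∫ ω, W t h ω ∂Q = 0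
  cov : ∀ s t h k, ∫ ω, W s h ω * W t k ω ∂Q = (min s t : ℝ≥0) * inner ℝ h k
  continuous : ∀ h, ∀ᵐ ω ∂Q, Continuous fun t => W t h ω

/-- The augmentation, by the null sets, of the filtration generated by `W`. -/
def augFiltration (W : ℝ≥0 → H → Ω → ℝ) (Q : Measure Ω) (hW : IsCylindricalWiener W Q) :
    Filtration ℝ≥0 mΩ where
  seq t := (⨆ s ≤ t, ⨆ h, MeasurableSpace.comap (W s h) inferInstance) ⊔
    MeasurableSpace.generateFrom {N | MeasurableSet N ∧ Q N = 0}
  mono' _ _ hst := sup_le_sup_right (biSup_mono fun _ h => h.trans hst) _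
  le' _ := sup_le (iSup₂_le fun s _ => iSup_le fun h => (hW.measurable s h).comap_le)
    (MeasurableSpace.generateFrom_le fun _ h => h.1)

/-- The squared Hilbert–Schmidt norm `∑ᵢ ‖A eᵢ‖²`, for an orthonormal basis `(eᵢ)` of `H` (the value
does not depend on the basis). For `G = ℝ` this is the squared norm of `H^*`. -/
def hsNormSq [CompleteSpace H] (A : H →L[ℝ] G) : ℝ≥0∞ :=
  ∑' e : (exists_hilbertBasis ℝ H).choose, ‖A e‖ₑ ^ 2

/-- An elementary integrand `1_{(left, right]}(s) c(ω) ⟨dir, ·⟩`, where `c` is bounded, `G`-valued and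
measurable at the time `left`. -/
structure Block (𝓕 : Filtration ℝ≥0 mΩ) (H : Type*) [NormedAddCommGroup H] [InnerProductSpace ℝ H]
    (G : Type*) [NormedAddCommGroup G] [InnerProductSpace ℝ G] where
  left : ℝ≥0
  right : ℝ≥0
  le : left ≤ right
  dir : H
  coeff : Ω → G
  measurable_coeff : StronglyMeasurable[𝓕 left] coeff
  bounded_coeff : ∃ C : ℝ, ∀ ω, ‖coeff ω‖ ≤ C

/-- The operator-valued process defined by an elementary integrand. -/
def Block.integrand {𝓕 : Filtration ℝ≥0 mΩ} (b : Block 𝓕 H G) (s : ℝ≥0) (ω : Ω) : H →L[ℝ] G :=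
  (Ioc b.left b.right).indicator (fun _ => (innerSL ℝ b.dir).smulRight (b.coeff ω)) s

/-- The integral over `[0, t]` of an elementary integrand. -/
def Block.integral {𝓕 : Filtration ℝ≥0 mΩ} (W : ℝ≥0 → H → Ω → ℝ) (t : ℝ≥0) (b : Block 𝓕 H G)
    (ω : Ω) : G :=
  (W (min b.right t) b.dir ω - W (min b.left t) b.dir ω) • b.coeff ω

/-- The simple integrand that is the sum of a finite list of elementary ones. -/
def simpleIntegrand {𝓕 : Filtration ℝ≥0 mΩ} (S : List (Block 𝓕 H G)) (s : ℝ≥0) (ω : Ω) :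
    H →L[ℝ] G :=
  (S.map fun b => b.integrand s ω).sum

/-- The integral over `[0, t]` of a simple integrand. -/
def simpleIntegral {𝓕 : Filtration ℝ≥0 mΩ} (W : ℝ≥0 → H → Ω → ℝ) (t : ℝ≥0)
    (S : List (Block 𝓕 H G)) (ω : Ω) : G :=
  (S.map fun b => b.integral W t ω).sum

/-- `Y = ∫₀ᵗ α_s dW_s` almost surely: `α` is a measurable, adapted, square-integrable process valued
in the Hilbert–Schmidt operators, and `Y` is the mean-square limit of the integrals of simple
integrands converging to `α` in `L²([0, t] × Ω)`. -/
structure IsItoIntegral [CompleteSpace H] (𝓕 : Filtration ℝ≥0 mΩ) (W : ℝ≥0 → H → Ω → ℝ)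
    (Q : Measure Ω) (t : ℝ≥0) (α : ℝ≥0 → Ω → H →L[ℝ] G) (Y : Ω → G) : Prop where
  measurable : StronglyMeasurable fun q : Iic t × Ω => α q.1 q.2
  adapted : ∀ s ≤ t, StronglyMeasurable[𝓕 s] (α s)
  sq_integrable : ∫⁻ q, hsNormSq (α q.1 q.2) ∂(leb t).prod Q < ∞
  aestronglyMeasurable : AEStronglyMeasurable Y Q
  limit : ∃ S : ℕ → List (Block 𝓕 H G),
    Tendsto (fun n => ∫⁻ q, hsNormSq (α q.1 q.2 - simpleIntegrand (S n) q.1 q.2) ∂(leb t).prod Q)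
      atTop (𝓝 0) ∧
    Tendsto (fun n => ∫⁻ ω, ‖Y ω - simpleIntegral W t (S n) ω‖ₑ ^ 2 ∂Q) atTop (𝓝 0)

/-! ### The bond market -/

/-- The model of the discounted bond price curves `P t ω ∈ F_w^2` with volatility `σ`, where
`P t ω s` is the discounted price at time `t` of the bond maturing at time `s`. -/
structure IsBondModel [CompleteSpace H] (p : WeightPair) (𝓕 : Filtration ℝ≥0 mΩ)
    (W : ℝ≥0 → H → Ω → ℝ) (Q : Measure Ω) (P : ℝ≥0 → Ω → F2 p.w)
    (σ : ℝ≥0 → Ω → H →L[ℝ] F2 p.w) : Prop where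
  measurable_P : StronglyMeasurable (Function.uncurry P)
  adapted_P : StronglyAdapted 𝓕 P
  measurable_σ : StronglyMeasurable (Function.uncurry σ)
  adapted_σ : StronglyAdapted 𝓕 σ
  hilbertSchmidt : ∀ t ω, hsNormSq (σ t ω) < ∞
  initial : ∃ P₀ : F2 p.w, ∀ᵐ ω ∂Q, P 0 ω = P₀
  /-- `dP_t = σ_t dW_t` -/
  dynamics : ∀ t, IsItoIntegral 𝓕 W Q t σ (fun ω => P t ω - P 0 ω)
  /-- `σ_t^* δ_s = 0` for `s ≤ t` -/
  expired : ∀ T : ℝ≥0, ∀ᵐ q ∂(leb T).prod Q, ∀ s ≤ q.1, p.adj (σ q.1 q.2) (p.δ s) = 0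
  positive : ∀ t, ∀ᵐ ω ∂Q, ∀ s, 0 < P t ω s
  integrable : ∀ t, ∫⁻ q, (ENNReal.ofReal
      (|rderiv (P q.1 q.2) q.1| * ‖P q.1 q.2‖ / (P q.1 q.2 q.1) ^ 2)
      + ENNReal.ofReal (1 + 1 / (P q.1 q.2 q.1) ^ 2) * hsNormSq (σ q.1 q.2)) ∂(leb t).prod Q < ∞

section Portfolios

variable {p : WeightPair}

/-- The (undiscounted) bond price curve `P_t / P_t(t)`, `P` being the discounted one. -/
def bondPrice (P : ℝ≥0 → Ω → F2 p.w) (t : ℝ≥0) (ω : Ω) : F2 p.w := (P t ω t)⁻¹ • P t ω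

/-- The drift `-(P_t'(t) / P_t(t)²) P_t` of the bond price curve, `P` being the discounted one. -/
def bondDrift (P : ℝ≥0 → Ω → F2 p.w) (t : ℝ≥0) (ω : Ω) : F2 p.w :=
  (-(rderiv (P t ω) t / (P t ω t) ^ 2)) • P t ω

/-- The volatility `σ_t / P_t(t)` of the bond price curve, `P` being the discounted one. -/
def bondVol (P : ℝ≥0 → Ω → F2 p.w) (σ : ℝ≥0 → Ω → H →L[ℝ] F2 p.w) (t : ℝ≥0) (ω : Ω) :
    H →L[ℝ] F2 p.w :=
  (P t ω t)⁻¹ • σ t ω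

/-- The value `⟨φ_t, P_t⟩_F` of the portfolio `φ_t`, at undiscounted bond prices. -/
def portfolioValue (P : ℝ≥0 → Ω → F2 p.w) (φ : ℝ≥0 → Ω → p.Fdual) (t : ℝ≥0) (ω : Ω) : ℝ :=
  φ t ω (p.incl (bondPrice P t ω))

variable [CompleteSpace H] (𝓕 : Filtration ℝ≥0 mΩ) (W : ℝ≥0 → H → Ω → ℝ) (Q : Measure Ω)

/-- `Y = ∫₀ᵗ ⟨φ_s, dX_s⟩_F` almost surely, where `dX_s = b_s ds + A_s dW_s`; that is,
`Y = ∫₀ᵗ ⟨φ_s, b_s⟩_F ds + ∫₀ᵗ A_s^* φ_s dW_s`, both integrals being defined. -/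
def IsPortfolioIntegral (b : ℝ≥0 → Ω → F2 p.w) (A : ℝ≥0 → Ω → H →L[ℝ] F2 p.w)
    (φ : ℝ≥0 → Ω → p.Fdual) (t : ℝ≥0) (Y : Ω → ℝ) : Prop :=
  (∀ᵐ ω ∂Q, Integrable (fun s => φ s ω (p.incl (b s ω))) (leb t)) ∧
  IsItoIntegral 𝓕 W Q t (fun s ω => p.adj (A s ω) (φ s ω))
    (fun ω => Y ω - ∫ s, φ s ω (p.incl (b s ω)) ∂leb t)

/-- A strategy on `[0, T]`: a measurable adapted `F^*`-valued process with `φ_t` in the closed span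
of the `δ_s`, `s ≥ t`, for almost every `(t, ω)`. -/
structure IsStrategy (T : ℝ≥0) (φ : ℝ≥0 → Ω → p.Fdual) : Prop where
  measurable : StronglyMeasurable fun q : Iic T × Ω => φ q.1 q.2
  adapted : ∀ t ≤ T, StronglyMeasurable[𝓕 t] (φ t)
  mem : ∀ᵐ q ∂(leb T).prod Q, φ q.1 q.2 ∈ p.closedSpan (Ici q.1)

/-- A self-financing strategy on `[0, T]`: `d⟨φ_t, P_t⟩ = ⟨φ_t, dP_t⟩` for the undiscounted prices. -/
structure IsSelfFinancing (P : ℝ≥0 → Ω → F2 p.w) (σ : ℝ≥0 → Ω → H →L[ℝ] F2 p.w) (T : ℝ≥0)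
    (φ : ℝ≥0 → Ω → p.Fdual) : Prop extends IsStrategy 𝓕 Q T φ where
  selfFinancing : ∀ t ≤ T, IsPortfolioIntegral 𝓕 W Q (bondDrift P) (bondVol P σ) φ t
    (fun ω => portfolioValue P φ t ω - portfolioValue P φ 0 ω)

/-- The discounted claim `ξ / B_T`, where the bank account is `B_T = 1 / P_T(T)` for the discounted
price `P`. -/
def discounted (P : ℝ≥0 → Ω → F2 p.w) (T : ℝ≥0) (ξ : Ω → ℝ) (ω : Ω) : ℝ := P T ω T * ξ ω

/-- A pre-hedging strategy for the claim `ξ` with maturity `T`: the discounted claim is its mean plus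
`∫₀ᵀ ⟨φ_s, dP_s⟩` for the discounted prices `P`. -/
structure IsPreHedging (P : ℝ≥0 → Ω → F2 p.w) (σ : ℝ≥0 → Ω → H →L[ℝ] F2 p.w) (T : ℝ≥0)
    (ξ : Ω → ℝ) (φ : ℝ≥0 → Ω → p.Fdual) : Prop extends IsStrategy 𝓕 Q T φ where
  integrable : Integrable (discounted P T ξ) Q
  represents : IsPortfolioIntegral 𝓕 W Q (fun _ _ => 0) σ φ T
    (fun ω => discounted P T ξ ω - ∫ ω', discounted P T ξ ω' ∂Q)

/-- A hedging strategy for the claim `ξ` with maturity `T`: a self-financing pre-hedging strategy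
whose value at time `T` is the payout `ξ`. -/
structure IsHedging (P : ℝ≥0 → Ω → F2 p.w) (σ : ℝ≥0 → Ω → H →L[ℝ] F2 p.w) (T : ℝ≥0)
    (ξ : Ω → ℝ) (φ : ℝ≥0 → Ω → p.Fdual) : Prop where
  selfFinancing : IsSelfFinancing 𝓕 W Q P σ T φ
  preHedging : IsPreHedging 𝓕 W Q P σ T ξ φ
  replicates : ∀ᵐ ω ∂Q, portfolioValue P φ T ω = ξ ω

end Portfolios

end Stochastic

end

end BondMarket

open BondMarket

/-! Write `D` for the difference of the values of the two strategies. Both portfolio integrals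
against the discounted prices represent the same discounted claim, so the Itô isometry forces `σ_t^*
φ¹_t = σ_t^* φ²_t` almost everywhere (`IsPreHedging.ae_adj_eq`). By the kernel condition, `φ¹_t -
φ²_t` lies in the closed span of the `δ_s` with `s ≤ t`. As a difference of strategies it also lies
in the closed span of those with `s ≥ t`. A function vanishing at `t` splits into a piece supported
before `t` and a piece supported after `t`, so such a functional vanishes on the kernel of `δ_t` and
is a multiple `c δ_t` (`WeightPair.exists_eq_smul_δ`). The bond maturing now has price 1, so `c =
D_t`.

It remains to see that `D = 0`. Once the martingale parts agree, self-financing leaves only a drift.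
The drift of the price curve is the short rate times the curve itself, so `D` solves a linear
homogeneous equation. Replication gives `D_T = 0`, the short rate is integrable along almost every
path, and Grönwall's inequality run backwards from `T` gives `D = 0`
(`IsSelfFinancing.ae_value_sub_eq_zero`).

The isometry is derived from the Gaussian structure of `W`: first for simple integrands, then for
mean-square limits. -/

namespace BondMarket

/-! ### Moments and independence of the Wiener increments -/

section Wiener

variable {Ω : Type*} [mΩ : MeasurableSpace Ω] {Q : Measure Ω}
variable {H : Type*} [NormedAddCommGroup H] [InnerProductSpace ℝ H] {W : ℝ≥0 → H → Ω → ℝ}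

theorem IsCylindricalWiener.memLp_two (hW : IsCylindricalWiener W Q) (t : ℝ≥0) (h : H) :
    MemLp (W t h) 2 Q :=
  (hW.gaussian.hasGaussianLaw_eval (t, h)).memLp_two

theorem IsCylindricalWiener.integrable_mul (hW : IsCylindricalWiener W Q) (s t : ℝ≥0) (h k : H) :
    Integrable (fun ω => W s h ω * W t k ω) Q :=
  (hW.memLp_two s h).integrable_mul (hW.memLp_two t k)

theorem IsCylindricalWiener.memLp_increment (hW : IsCylindricalWiener W Q) (s t : ℝ≥0) (h : H) :
    MemLp (fun ω => W t h ω - W s h ω) 2 Q :=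
  (hW.memLp_two t h).sub (hW.memLp_two s h)

theorem IsCylindricalWiener.integral_increment [IsFiniteMeasure Q]
    (hW : IsCylindricalWiener W Q) (s t : ℝ≥0) (h : H) :
    ∫ ω, (W t h ω - W s h ω) ∂Q = 0 := by
  rw [integral_sub ((hW.memLp_two t h).integrable one_le_two)
    ((hW.memLp_two s h).integrable one_le_two), hW.mean, hW.mean, sub_zero]

theorem IsCylindricalWiener.integral_increment_mul_increment
    (hW : IsCylindricalWiener W Q) {a r r' : ℝ≥0} (hr : a ≤ r) (hr' : a ≤ r') (h h' : H) :
    ∫ ω, (W r h ω - W a h ω) * (W r' h' ω - W a h' ω) ∂Q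
      = ((min r r' : ℝ≥0) - a) * inner ℝ h h' := by
  have hi := hW.integrable_mul
  have hi' : ∀ s t u k k', Integrable (fun ω => W s k ω * W t k' ω - W s k ω * W u k' ω) Q :=
    fun s t u k k' => (hi s t k k').sub (hi s u k k')
  have hrw : ∀ ω, (W r h ω - W a h ω) * (W r' h' ω - W a h' ω)
      = (W r h ω * W r' h' ω - W r h ω * W a h' ω)
        - (W a h ω * W r' h' ω - W a h ω * W a h' ω) := fun ω => by ring
  simp_rw [hrw]
  rw [integral_sub (hi' _ _ _ _ _) (hi' _ _ _ _ _),
    integral_sub (hi _ _ _ _) (hi _ _ _ _), integral_sub (hi _ _ _ _) (hi _ _ _ _),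
    hW.cov, hW.cov, hW.cov, hW.cov, min_eq_right hr, min_eq_left hr', min_self]
  ring

/-- The increments after time `a` are independent of the process up to time `a`. -/
theorem IsCylindricalWiener.indepFun_past_future [IsFiniteMeasure Q]
    (hW : IsCylindricalWiener W Q) (a : ℝ≥0) :
    IndepFun (fun ω (q : Iic a × H) => W q.1 q.2 ω)
      (fun ω (q : Ici a × H) => W q.1 q.2 ω - W a q.2 ω) Q := by
  have : IsProbabilityMeasure Q := hW.gaussian.isProbabilityMeasure
  refine IsGaussianProcess.indepFun_of_covariance_eq_zero
    (X := fun (q : Iic a × H) ω => W q.1 q.2 ω)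
    (Y := fun (q : Ici a × H) ω => W q.1 q.2 ω - W a q.2 ω) ?_
    (fun q => (hW.measurable _ _).aemeasurable)
    (fun q => ((hW.measurable _ _).sub (hW.measurable _ _)).aemeasurable) ?_
  · classical
    -- Past values and future increments are linear in finitely many values of `W`, hence jointly
    -- Gaussian. Independence is then a matter of zero covariance.
    refine hW.gaussian.of_isGaussianProcess fun s => ?_
    rcases s with q | q
    · exact ⟨{((q.1 : ℝ≥0), q.2)},
        { toFun := fun x => x ⟨((q.1 : ℝ≥0), q.2), by simp⟩
          map_add' := by simp
          map_smul' := by simp }, by simp⟩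
    · exact ⟨{((q.1 : ℝ≥0), q.2), (a, q.2)},
        { toFun := fun x => x ⟨((q.1 : ℝ≥0), q.2), by simp⟩ - x ⟨(a, q.2), by simp⟩
          map_add' := fun x y => by simp; abel
          map_smul' := fun c x => by simp; ring }, by simp⟩
  · rintro ⟨⟨s, hs⟩, h⟩ ⟨⟨t, ht⟩, k⟩
    rw [mem_Iic] at hs
    rw [mem_Ici] at ht
    rw [covariance_eq_sub (hW.memLp_two _ _) (hW.memLp_increment _ _ _), hW.mean, zero_mul,
      sub_zero]
    simp only [Pi.mul_apply, mul_sub]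
    rw [integral_sub (hW.integrable_mul s t h k) (hW.integrable_mul s a h k), hW.cov, hW.cov,
      min_eq_left hs, min_eq_left (hs.trans ht), sub_self]

/-- Adding null sets changes each event only up to a null set, so independence of the raw past from
the future increments carries over to the augmented filtration. -/
theorem augFiltration_le_eventuallyMeasurableSpace (hW : IsCylindricalWiener W Q) (a : ℝ≥0) :
    augFiltration W Q hW a ≤ eventuallyMeasurableSpace
      (MeasurableSpace.comap (fun ω (q : Iic a × H) => W q.1 q.2 ω) inferInstance) (ae Q) := by
  refine sup_le (iSup₂_le fun s hs => iSup_le fun h => ?_)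
    (MeasurableSpace.generateFrom_le fun N hN => ?_)
  · rintro _ ⟨B, hB, rfl⟩
    exact ⟨_, ⟨(fun f : Iic a × H → ℝ => f (⟨s, hs⟩, h)) ⁻¹' B, measurable_pi_apply _ hB, rfl⟩,
      ae_eq_refl _⟩
  · exact ⟨∅, MeasurableSpace.measurableSet_empty _, ae_eq_empty.2 hN.2⟩

theorem IsCylindricalWiener.indep_augFiltration [IsFiniteMeasure Q]
    (hW : IsCylindricalWiener W Q) (a : ℝ≥0) :
    Indep (augFiltration W Q hW a)
      (MeasurableSpace.comap (fun ω (q : Ici a × H) => W q.1 q.2 ω - W a q.2 ω)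
        inferInstance) Q := by
  rw [Indep_iff]
  intro A B hA hB
  obtain ⟨A', hA', hAA'⟩ := augFiltration_le_eventuallyMeasurableSpace hW a A hA
  have h := (Indep_iff _ _ _).1 (hW.indepFun_past_future a) A' B hA' hB
  rw [measure_congr (hAA'.inter (ae_eq_refl B)), measure_congr hAA', h]

theorem IsCylindricalWiener.indepFun_of_stronglyMeasurable [IsFiniteMeasure Q]
    (hW : IsCylindricalWiener W Q) {a : ℝ≥0} {Z : Ω → ℝ}
    (hZ : StronglyMeasurable[augFiltration W Q hW a] Z) {g : (Ici a × H → ℝ) → ℝ}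
    (hg : Measurable g) :
    IndepFun Z (fun ω => g fun q => W q.1 q.2 ω - W a q.2 ω) Q := by
  refine indep_of_indep_of_le_left (indep_of_indep_of_le_right (hW.indep_augFiltration a) ?_)
    hZ.measurable.comap_le
  exact Measurable.comap_le (hg.comp (comap_measurable _))

/-- Integrability of `Z` is not needed: for independent factors the product rule for integrals
survives the convention that a non-integrable function has integral zero. -/
theorem IsCylindricalWiener.integral_mul_increment [IsFiniteMeasure Q]
    (hW : IsCylindricalWiener W Q) {a r : ℝ≥0} (hr : a ≤ r) (h : H) {Z : Ω → ℝ}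
    (hZ : StronglyMeasurable[augFiltration W Q hW a] Z) :
    ∫ ω, Z ω * (W r h ω - W a h ω) ∂Q = 0 := by
  have hi := hW.indepFun_of_stronglyMeasurable hZ
    (g := fun f => f (⟨r, hr⟩, h)) (measurable_pi_apply _)
  rw [hi.integral_fun_mul_eq_mul_integral
    (hZ.mono ((augFiltration W Q hW).le a)).aestronglyMeasurable
    ((hW.measurable r h).sub (hW.measurable a h)).aestronglyMeasurable,
    hW.integral_increment, mul_zero]

theorem IsCylindricalWiener.integral_mul_increment_mul_increment [IsFiniteMeasure Q]
    (hW : IsCylindricalWiener W Q) {a r r' : ℝ≥0} (hr : a ≤ r) (hr' : a ≤ r') (h h' : H)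
    {Z : Ω → ℝ} (hZ : StronglyMeasurable[augFiltration W Q hW a] Z) :
    ∫ ω, Z ω * ((W r h ω - W a h ω) * (W r' h' ω - W a h' ω)) ∂Q
      = (∫ ω, Z ω ∂Q) * (((min r r' : ℝ≥0) - a) * inner ℝ h h') := by
  have hi := hW.indepFun_of_stronglyMeasurable hZ
    (g := fun f => f (⟨r, hr⟩, h) * f (⟨r', hr'⟩, h'))
    ((measurable_pi_apply _).mul (measurable_pi_apply _))
  rw [hi.integral_fun_mul_eq_mul_integral
    (hZ.mono ((augFiltration W Q hW).le a)).aestronglyMeasurable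
    (((hW.measurable r h).sub (hW.measurable a h)).mul
      ((hW.measurable r' h').sub (hW.measurable a h'))).aestronglyMeasurable,
    hW.integral_increment_mul_increment hr hr']

theorem IsCylindricalWiener.stronglyMeasurable_aug (hW : IsCylindricalWiener W Q) {s a : ℝ≥0}
    (hs : s ≤ a) (h : H) : StronglyMeasurable[augFiltration W Q hW a] (W s h) := by
  refine Measurable.stronglyMeasurable ?_
  refine Measurable.mono (comap_measurable (W s h)) ?_ le_rfl
  refine le_trans ?_ le_sup_left
  exact le_iSup₂_of_le s hs (le_iSup (fun h => MeasurableSpace.comap (W s h) _) h)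

end Wiener

/-! ### Lebesgue measure on `[0, t]` -/

section Leb

theorem leb_apply {t : ℝ≥0} {s : Set ℝ≥0} (hs : MeasurableSet s) :
    leb t s = volume (Real.toNNReal ⁻¹' s ∩ Icc (0 : ℝ) t) := by
  rw [leb, Measure.map_apply measurable_real_toNNReal hs,
    Measure.restrict_apply (measurable_real_toNNReal hs)]

instance (t : ℝ≥0) : IsFiniteMeasure (leb t) := by
  unfold leb; infer_instance

/-- `ENNReal.ofReal` truncates negative lengths to zero, so no order between `a`, `b` and `t` has to
be assumed. -/
theorem leb_Ioc (t a b : ℝ≥0) : leb t (Ioc a b) = ENNReal.ofReal ((min b t : ℝ≥0) - a) := by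
  have : Real.toNNReal ⁻¹' Ioc a b ∩ Icc (0 : ℝ) t = Ioc (a : ℝ) (min b t : ℝ≥0) := by
    ext u
    simp only [mem_inter_iff, mem_preimage, mem_Ioc, mem_Icc, NNReal.coe_min, le_min_iff,
      Real.lt_toNNReal_iff_coe_lt, Real.toNNReal_le_iff_le_coe]
    have := a.2
    constructor
    · rintro ⟨⟨h1, h2⟩, h3, h4⟩; exact ⟨h1, h2, h4⟩
    · rintro ⟨h1, h2, h4⟩; exact ⟨⟨h1, h2⟩, this.trans h1.le, h4⟩
  rw [leb_apply measurableSet_Ioc, this, Real.volume_Ioc]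

instance (t : ℝ≥0) : NullSingletonClass (leb t) where
  measure_singleton a := by
    rw [leb_apply (measurableSet_singleton a)]
    -- For `a = 0` the preimage under `Real.toNNReal` is a whole half-line; intersecting it with
    -- `[0, t]` leaves at most a point.
    refine measure_mono_null (t := {(a : ℝ)}) ?_ (by simp)
    rintro u ⟨h1, h2, -⟩
    rw [mem_preimage, mem_singleton_iff] at h1
    rw [mem_singleton_iff, ← h1, Real.coe_toNNReal u h2]

theorem leb_restrict_Iic {s t : ℝ≥0} (hst : s ≤ t) : (leb t).restrict (Iic s) = leb s := by
  ext B hB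
  rw [Measure.restrict_apply hB, leb_apply (hB.inter measurableSet_Iic), leb_apply hB]
  congr 1
  ext u
  have hst' : (s : ℝ) ≤ t := hst
  simp only [mem_inter_iff, mem_preimage, mem_Iic, mem_Icc, Real.toNNReal_le_iff_le_coe]
  constructor
  · rintro ⟨⟨h1, h2⟩, h3, -⟩; exact ⟨h1, h3, h2⟩
  · rintro ⟨h1, h2, h3⟩; exact ⟨⟨h1, h3⟩, h2, h3.trans hst'⟩

theorem leb_le {s t : ℝ≥0} (hst : s ≤ t) : leb s ≤ leb t := by
  rw [← leb_restrict_Iic hst]; exact Measure.restrict_le_self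

theorem ae_leb_le (t : ℝ≥0) : ∀ᵐ s ∂leb t, s ≤ t := by
  rw [← leb_restrict_Iic le_rfl]
  exact ae_restrict_mem measurableSet_Iic

variable {Ω : Type*} [mΩ : MeasurableSpace Ω]

theorem ae_leb_prod_le (t : ℝ≥0) (Q : Measure Ω) [SFinite Q] :
    ∀ᵐ q ∂(leb t).prod Q, q.1 ≤ t :=
  Measure.quasiMeasurePreserving_fst.ae (ae_leb_le t)

/-- Strategies and integrands are measurable only up to the horizon; an extension to all times makes
Fubini's theorem applicable on `ℝ≥0 × Ω`. -/
theorem exists_stronglyMeasurable_eq_of_le {E : Type*} [TopologicalSpace E] [Nonempty E] {t : ℝ≥0}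
    {α : ℝ≥0 → Ω → E} (hα : StronglyMeasurable fun q : Iic t × Ω => α q.1 q.2) :
    ∃ β : ℝ≥0 → Ω → E, StronglyMeasurable (Function.uncurry β) ∧ ∀ s ≤ t, β s = α s := by
  have he : MeasurableEmbedding (Prod.map Subtype.val id : Iic t × Ω → ℝ≥0 × Ω) :=
    (MeasurableEmbedding.subtype_coe measurableSet_Iic).prodMap .id
  obtain ⟨f, hf, hfα⟩ := he.exists_stronglyMeasurable_extend hα (fun _ => inferInstance)
  exact ⟨fun s ω => f (s, ω), hf, fun s hs => funext fun ω => congrFun hfα (⟨s, hs⟩, ω)⟩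

theorem aestronglyMeasurable_of_Iic {E : Type*} [TopologicalSpace E] [Nonempty E] {t : ℝ≥0}
    {α : ℝ≥0 → Ω → E} (hα : StronglyMeasurable fun q : Iic t × Ω => α q.1 q.2) (Q : Measure Ω)
    [SFinite Q] : AEStronglyMeasurable (fun q => α q.1 q.2) ((leb t).prod Q) := by
  obtain ⟨β, hβ, hαβ⟩ := exists_stronglyMeasurable_eq_of_le hα
  refine ⟨Function.uncurry β, hβ, ?_⟩
  filter_upwards [ae_leb_prod_le t Q] with q hq
  exact (congrFun (hαβ q.1 hq) q.2).symm

end Leb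

theorem enorm_sq_eq_ofReal {E : Type*} [NormedAddCommGroup E] (x : E) :
    ‖x‖ₑ ^ 2 = ENNReal.ofReal (‖x‖ ^ 2) := by
  rw [ENNReal.ofReal_pow (norm_nonneg _), ofReal_norm]

/-! ### The Hilbert–Schmidt norm of a functional -/

section HilbertSchmidt

variable {H : Type*} [NormedAddCommGroup H] [InnerProductSpace ℝ H] [CompleteSpace H]

/-- Parseval's identity for the Riesz vector of `A`. It turns the Hilbert–Schmidt distances of
real-valued integrands into ordinary `L²` distances. -/
theorem hsNormSq_eq_enorm_sq (A : H →L[ℝ] ℝ) : hsNormSq A = ‖A‖ₑ ^ 2 := by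
  obtain ⟨b, hb⟩ := (exists_hilbertBasis ℝ H).choose_spec
  set x := (InnerProductSpace.toDual ℝ H).symm A with hx
  have hA : ∀ y, A y = inner ℝ x y := fun y => by simp [hx]
  have h1 : ∀ e : (exists_hilbertBasis ℝ H).choose,
      ‖A e‖ₑ ^ 2 = ENNReal.ofReal (inner ℝ x (b e) * inner ℝ (b e) x) := fun e => by
    rw [hA, hb, real_inner_comm x, ← pow_two, enorm_sq_eq_ofReal, Real.norm_eq_abs, sq_abs]
  have h2 := b.hasSum_inner_mul_inner x x
  rw [hsNormSq, tsum_congr h1, ← ENNReal.ofReal_tsum_of_nonneg _ h2.summable, h2.tsum_eq,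
    real_inner_self_eq_norm_sq, hx, LinearIsometryEquiv.norm_map, ← enorm_sq_eq_ofReal]
  intro e
  rw [real_inner_comm x]
  exact mul_self_nonneg _

end HilbertSchmidt

theorem eLpNorm_two_eq {α E : Type*} [MeasurableSpace α] [NormedAddCommGroup E] (f : α → E)
    (μ : Measure α) : eLpNorm f 2 μ = (∫⁻ a, ‖f a‖ₑ ^ 2 ∂μ) ^ (1 / 2 : ℝ) := by
  rw [eLpNorm_eq_lintegral_rpow_enorm_toReal (by norm_num) (by norm_num)]
  norm_num

/-! ### The Itô isometry for simple integrands -/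

section Isometry

variable {Ω : Type*} [mΩ : MeasurableSpace Ω] {Q : Measure Ω}
variable {H : Type*} [NormedAddCommGroup H] [InnerProductSpace ℝ H] {W : ℝ≥0 → H → Ω → ℝ}

theorem Block.memLp_smul_coeff {𝓕 : Filtration ℝ≥0 mΩ} (b : Block 𝓕 H ℝ) {X : Ω → ℝ}
    (hX : MemLp X 2 Q) : MemLp (fun ω => X ω • b.coeff ω) 2 Q := by
  obtain ⟨C, hC⟩ := b.bounded_coeff
  refine hX.of_le_mul (c := C)
    (hX.1.smul (b.measurable_coeff.mono (𝓕.le _)).aestronglyMeasurable) (ae_of_all _ fun ω => ?_)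
  rw [norm_smul, mul_comm]
  exact mul_le_mul_of_nonneg_right (hC ω) (norm_nonneg _)

theorem Block.memLp_integral (hW : IsCylindricalWiener W Q) (t : ℝ≥0)
    (b : Block (augFiltration W Q hW) H ℝ) : MemLp (b.integral W t) 2 Q :=
  b.memLp_smul_coeff (hW.memLp_increment _ _ _)

theorem simpleIntegral_eq_sum {𝓕 : Filtration ℝ≥0 mΩ} (t : ℝ≥0) (S : List (Block 𝓕 H ℝ)) (ω : Ω) :
    simpleIntegral W t S ω = ∑ i : Fin S.length, (S.get i).integral W t ω := by
  exact (Fin.sum_univ_fun_getElem S fun b => b.integral W t ω).symm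

theorem memLp_simpleIntegral (hW : IsCylindricalWiener W Q) (t : ℝ≥0)
    (S : List (Block (augFiltration W Q hW) H ℝ)) : MemLp (simpleIntegral W t S) 2 Q := by
  have : simpleIntegral W t S = fun ω => ∑ i : Fin S.length, (S.get i).integral W t ω :=
    funext (simpleIntegral_eq_sum t S)
  rw [this]
  exact memLp_finsetSum _ fun i _ => (S.get i).memLp_integral hW t

variable [IsFiniteMeasure Q]

/-- The increment of the earlier block is cut at the left end of the later one. The piece before the
cut is known at that time and is multiplied by a centred independent increment, so it contributes
nothing. The piece after the cut contributes the length of the overlap. -/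
theorem Block.integral_mul_integral_of_le (hW : IsCylindricalWiener W Q) (t : ℝ≥0)
    (b b' : Block (augFiltration W Q hW) H ℝ) (hbb : b.left ≤ b'.left) :
    ∫ ω, b.integral W t ω * b'.integral W t ω ∂Q
      = (leb t).real (Ioc b.left b.right ∩ Ioc b'.left b'.right)
        * ((∫ ω, b.coeff ω * b'.coeff ω ∂Q) * inner ℝ b.dir b'.dir) := by
  rw [Ioc_inter_Ioc, sup_eq_right.2 hbb, Measure.real, leb_Ioc]
  rcases le_or_gt t b'.left with ht | ht
  · have h0 : ∀ ω, b'.integral W t ω = 0 := fun ω => by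
      rw [Block.integral, min_eq_right ht, min_eq_right (ht.trans b'.le), sub_self, zero_smul]
    have h1 : ((min (b.right ⊓ b'.right) t : ℝ≥0) : ℝ) - b'.left ≤ 0 :=
      sub_nonpos.2 (NNReal.coe_le_coe.2 ((min_le_right _ _).trans ht))
    rw [ENNReal.ofReal_of_nonpos h1]
    simp [h0]
  set a := b'.left
  set R := min b.right t with hR
  set R' := min b'.right t with hR'
  have haR' : a ≤ R' := le_min b'.le ht.le
  -- The `min` and `max` with `a` treat uniformly the case where the earlier block ends before `a`;
  -- then `X₂` is zero.
  set X₁ : Ω → ℝ := fun ω => W (min R a) b.dir ω - W b.left b.dir ω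
  set X₂ : Ω → ℝ := fun ω => W (max R a) b.dir ω - W a b.dir ω
  set X' : Ω → ℝ := fun ω => W R' b'.dir ω - W a b'.dir ω
  have hc := b.measurable_coeff.mono ((augFiltration W Q hW).mono hbb)
  have hc' := b'.measurable_coeff
  have hsplit : ∀ ω, b.integral W t ω * b'.integral W t ω
      = (X₁ ω • b.coeff ω) * (X' ω • b'.coeff ω) + (X₂ ω • b.coeff ω) * (X' ω • b'.coeff ω) := by
    intro ω
    simp only [Block.integral, ← hR, ← hR', min_eq_left (hbb.trans ht.le), X₁, X₂, X',
      min_eq_left ht.le, ← add_mul, ← add_smul, a]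
    congr 2
    rcases le_total R b'.left with h | h
    · rw [min_eq_left h, max_eq_right h]; ring
    · rw [min_eq_right h, max_eq_left h]; ring
  have hX' : MemLp (fun ω => X' ω • b'.coeff ω) 2 Q :=
    b'.memLp_smul_coeff (hW.memLp_increment _ _ _)
  have hi : ∀ {X : Ω → ℝ}, MemLp X 2 Q →
      Integrable (fun ω => (X ω • b.coeff ω) * (X' ω • b'.coeff ω)) Q := fun hX =>
    (b.memLp_smul_coeff hX).integrable_mul hX'
  simp_rw [hsplit]
  rw [integral_add (hi (hW.memLp_increment _ _ _)) (hi (hW.memLp_increment _ _ _))]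
  have e1 : ∫ ω, (X₁ ω • b.coeff ω) * (X' ω • b'.coeff ω) ∂Q = 0 := by
    rw [← hW.integral_mul_increment haR' b'.dir
      (Z := fun ω => X₁ ω * (b.coeff ω * b'.coeff ω))
      (((hW.stronglyMeasurable_aug (min_le_right _ _) _).sub
        (hW.stronglyMeasurable_aug hbb _)).mul (hc.mul hc'))]
    refine integral_congr_ae (ae_of_all _ fun ω => ?_)
    simp only [smul_eq_mul, X']; ring
  have e2 : ∫ ω, (X₂ ω • b.coeff ω) * (X' ω • b'.coeff ω) ∂Q
      = (∫ ω, b.coeff ω * b'.coeff ω ∂Q)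
        * (((min (max R a) R' : ℝ≥0) - a) * inner ℝ b.dir b'.dir) := by
    rw [← hW.integral_mul_increment_mul_increment (le_max_right R a) haR' b.dir b'.dir
      (Z := fun ω => b.coeff ω * b'.coeff ω) (hc.mul hc')]
    refine integral_congr_ae (ae_of_all _ fun ω => ?_)
    simp only [smul_eq_mul, X', X₂]; ring
  have hlen : (ENNReal.ofReal ((min (b.right ⊓ b'.right) t : ℝ≥0) - (a : ℝ))).toReal
      = (min (max R a) R' : ℝ≥0) - (a : ℝ) := by
    rw [ENNReal.toReal_ofReal']
    have h1 : (a : ℝ) ≤ R' := haR'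
    have h2 : ((min (b.right ⊓ b'.right) t : ℝ≥0) : ℝ) = min (R : ℝ) R' := by
      rw [hR, hR', ← NNReal.coe_min, inf_inf_distrib_right]
    rw [h2, NNReal.coe_min (max R a) R', NNReal.coe_max R a]
    rcases le_total (R : ℝ) a with h | h
    · rw [max_eq_right h, min_eq_left (h.trans h1), min_eq_left h1, sub_self,
        max_eq_right (sub_nonpos.2 h)]
    · rw [max_eq_left h, max_eq_left (sub_nonneg.2 (le_min h h1))]
  rw [e1, e2, zero_add, hlen]
  ring

theorem Block.integral_mul_integral (hW : IsCylindricalWiener W Q) (t : ℝ≥0)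
    (b b' : Block (augFiltration W Q hW) H ℝ) :
    ∫ ω, b.integral W t ω * b'.integral W t ω ∂Q
      = (leb t).real (Ioc b.left b.right ∩ Ioc b'.left b'.right)
        * ((∫ ω, b.coeff ω * b'.coeff ω ∂Q) * inner ℝ b.dir b'.dir) := by
  rcases le_total b.left b'.left with h | h
  · exact Block.integral_mul_integral_of_le hW t b b' h
  · have := Block.integral_mul_integral_of_le hW t b' b h
    simpa only [mul_comm (b'.integral W t _), mul_comm (b'.coeff _), inter_comm,
      real_inner_comm] using this

/-- The vector that represents an elementary integrand. -/
noncomputable def Block.vector {𝓕 : Filtration ℝ≥0 mΩ} (b : Block 𝓕 H ℝ) (q : ℝ≥0 × Ω) : H :=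
  ((Ioc b.left b.right).indicator (fun _ => (1 : ℝ)) q.1 * b.coeff q.2) • b.dir

theorem Block.innerSL_vector {𝓕 : Filtration ℝ≥0 mΩ} (b : Block 𝓕 H ℝ) (q : ℝ≥0 × Ω) :
    innerSL ℝ (b.vector q) = b.integrand q.1 q.2 := by
  ext x
  by_cases hq : q.1 ∈ Ioc b.left b.right <;>
    simp [Block.vector, Block.integrand, hq, mul_comm]

/-- The value is the same expression as in `Block.integral_mul_integral`, so the isometry can be
checked pair by pair. -/
theorem Block.integrable_inner_vector {𝓕 : Filtration ℝ≥0 mΩ} (t : ℝ≥0) (b b' : Block 𝓕 H ℝ) :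
    Integrable (fun q => inner ℝ (b.vector q) (b'.vector q)) ((leb t).prod Q) ∧
    ∫ q, inner ℝ (b.vector q) (b'.vector q) ∂(leb t).prod Q
      = (leb t).real (Ioc b.left b.right ∩ Ioc b'.left b'.right)
        * ((∫ ω, b.coeff ω * b'.coeff ω ∂Q) * inner ℝ b.dir b'.dir) := by
  have h : ∀ q : ℝ≥0 × Ω, inner ℝ (b.vector q) (b'.vector q)
      = (Ioc b.left b.right ∩ Ioc b'.left b'.right).indicator (fun _ => (1 : ℝ)) q.1
        * (b.coeff q.2 * b'.coeff q.2 * inner ℝ b.dir b'.dir) := fun q => by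
    by_cases h1 : q.1 ∈ Ioc b.left b.right <;> by_cases h2 : q.1 ∈ Ioc b'.left b'.right <;>
      simp [Block.vector, h1, h2, inner_smul_left, inner_smul_right, -mem_Ioc]; ring
  simp_rw [h]
  have hm : MeasurableSet (Ioc b.left b.right ∩ Ioc b'.left b'.right) :=
    measurableSet_Ioc.inter measurableSet_Ioc
  obtain ⟨C, hC⟩ := b.bounded_coeff
  obtain ⟨C', hC'⟩ := b'.bounded_coeff
  have hi : Integrable (fun ω => b.coeff ω * b'.coeff ω) Q := by
    refine Integrable.of_bound ((b.measurable_coeff.mono (𝓕.le _)).mul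
      (b'.measurable_coeff.mono (𝓕.le _))).aestronglyMeasurable (C * C') (ae_of_all _ fun ω => ?_)
    rw [norm_mul]
    exact mul_le_mul (hC ω) (hC' ω) (norm_nonneg _) ((norm_nonneg _).trans (hC ω))
  refine ⟨Integrable.mul_prod ((integrable_const _).indicator hm) (hi.mul_const _), ?_⟩
  rw [integral_prod_mul (fun s => (Ioc b.left b.right ∩ Ioc b'.left b'.right).indicator
      (fun _ => (1 : ℝ)) s) (fun ω => b.coeff ω * b'.coeff ω * inner ℝ b.dir b'.dir),
    integral_indicator_const _ hm, integral_mul_const, smul_eq_mul, mul_one]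

theorem simpleIntegrand_eq_innerSL {𝓕 : Filtration ℝ≥0 mΩ} (S : List (Block 𝓕 H ℝ))
    (q : ℝ≥0 × Ω) :
    simpleIntegrand S q.1 q.2 = innerSL ℝ (∑ i : Fin S.length, (S.get i).vector q) := by
  simp_rw [map_sum, Block.innerSL_vector]
  exact (Fin.sum_univ_fun_getElem S fun b => b.integrand q.1 q.2).symm

/-- The Itô isometry for simple integrands. -/
theorem lintegral_simpleIntegral_sq (hW : IsCylindricalWiener W Q) (t : ℝ≥0)
    (S : List (Block (augFiltration W Q hW) H ℝ)) :
    ∫⁻ ω, ‖simpleIntegral W t S ω‖ₑ ^ 2 ∂Q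
      = ∫⁻ q, ‖simpleIntegrand S q.1 q.2‖ₑ ^ 2 ∂(leb t).prod Q := by
  have h1 : ∀ ω, ‖simpleIntegral W t S ω‖ₑ ^ 2 = ENNReal.ofReal
      (∑ i : Fin S.length, ∑ j : Fin S.length,
        (S.get i).integral W t ω * (S.get j).integral W t ω) := fun ω => by
    rw [enorm_sq_eq_ofReal, simpleIntegral_eq_sum, Real.norm_eq_abs, sq_abs, pow_two, Finset.sum_mul_sum]
  have h2 : ∀ q : ℝ≥0 × Ω, ‖simpleIntegrand S q.1 q.2‖ₑ ^ 2 = ENNReal.ofReal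
      (∑ i : Fin S.length, ∑ j : Fin S.length,
        inner ℝ ((S.get i).vector q) ((S.get j).vector q)) := fun q => by
    rw [enorm_sq_eq_ofReal, simpleIntegrand_eq_innerSL, innerSL_apply_norm, ← real_inner_self_eq_norm_sq,
      sum_inner]
    simp_rw [inner_sum]
  have i1 : ∀ i j : Fin S.length, Integrable (fun ω =>
      (S.get i).integral W t ω * (S.get j).integral W t ω) Q := fun i j =>
    ((S.get i).memLp_integral hW t).integrable_mul ((S.get j).memLp_integral hW t)
  have i2 : ∀ i j : Fin S.length, Integrable (fun q =>
      inner ℝ ((S.get i).vector q) ((S.get j).vector q)) ((leb t).prod Q) := fun i j =>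
    (Block.integrable_inner_vector t _ _).1
  simp_rw [h1, h2]
  -- Single cross terms have no sign; only the full double sum is nonnegative. Hence the passage to
  -- Bochner integrals before the sums are taken out.
  rw [← ofReal_integral_eq_lintegral_ofReal, ← ofReal_integral_eq_lintegral_ofReal]
  · congr 1
    rw [integral_finsetSum _ fun i _ => integrable_finsetSum _ fun j _ => i1 i j,
      integral_finsetSum _ fun i _ => integrable_finsetSum _ fun j _ => i2 i j]
    refine Finset.sum_congr rfl fun i _ => ?_
    rw [integral_finsetSum _ fun j _ => i1 i j, integral_finsetSum _ fun j _ => i2 i j]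
    refine Finset.sum_congr rfl fun j _ => ?_
    rw [Block.integral_mul_integral, (Block.integrable_inner_vector t _ _).2]
  · exact integrable_finsetSum _ fun i _ => integrable_finsetSum _ fun j _ => i2 i j
  · refine ae_of_all _ fun q => ?_
    simp_rw [← inner_sum, ← sum_inner]
    exact real_inner_self_nonneg
  · exact integrable_finsetSum _ fun i _ => integrable_finsetSum _ fun j _ => i1 i j
  · refine ae_of_all _ fun ω => ?_
    simp only [← Finset.sum_mul_sum]
    exact mul_self_nonneg _

theorem _root_.List.sum_map_neg_eq {α E : Type*} [AddCommGroup E] (l : List α) (f : α → E) :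
    (l.map fun a => -f a).sum = -(l.map f).sum := by
  induction l with
  | nil => simp
  | cons a l ih => simp [ih, add_comm]

/-- The opposite of an elementary integrand. -/
noncomputable def Block.neg {𝓕 : Filtration ℝ≥0 mΩ} (b : Block 𝓕 H ℝ) : Block 𝓕 H ℝ where
  left := b.left
  right := b.right
  le := b.le
  dir := b.dir
  coeff := -b.coeff
  measurable_coeff := b.measurable_coeff.neg
  bounded_coeff := b.bounded_coeff.imp fun C hC ω => by simpa using hC ω

theorem simpleIntegral_append_neg {𝓕 : Filtration ℝ≥0 mΩ} (t : ℝ≥0) (S S' : List (Block 𝓕 H ℝ))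
    (ω : Ω) : simpleIntegral W t (S ++ S'.map Block.neg) ω
      = simpleIntegral W t S ω - simpleIntegral W t S' ω := by
  have h : ∀ b : Block 𝓕 H ℝ, b.neg.integral W t ω = -b.integral W t ω := fun b => by
    simp [Block.integral, Block.neg]
  simp only [simpleIntegral, List.map_append, List.map_map, List.sum_append, sub_eq_add_neg,
    Function.comp_def, h, List.sum_map_neg_eq]

theorem simpleIntegrand_append_neg {𝓕 : Filtration ℝ≥0 mΩ} (S S' : List (Block 𝓕 H ℝ))
    (s : ℝ≥0) (ω : Ω) : simpleIntegrand (S ++ S'.map Block.neg) s ω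
      = simpleIntegrand S s ω - simpleIntegrand S' s ω := by
  have h : ∀ b : Block 𝓕 H ℝ, b.neg.integrand s ω = -b.integrand s ω := fun b => by
    by_cases hs : s ∈ Ioc b.left b.right <;> ext <;>
      simp [Block.integrand, Block.neg, hs, -mem_Ioc]
  simp only [simpleIntegrand, List.map_append, List.map_map, List.sum_append, sub_eq_add_neg,
    Function.comp_def, h, List.sum_map_neg_eq]

/-- The difference of two simple integrands is again simple, with the opposite blocks appended, so
the isometry applies to it. -/
theorem eLpNorm_simpleIntegral_sub (hW : IsCylindricalWiener W Q) (t : ℝ≥0)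
    (S S' : List (Block (augFiltration W Q hW) H ℝ)) :
    eLpNorm (simpleIntegral W t S - simpleIntegral W t S') 2 Q
      = eLpNorm (fun q => simpleIntegrand S q.1 q.2 - simpleIntegrand S' q.1 q.2) 2
        ((leb t).prod Q) := by
  have := lintegral_simpleIntegral_sq hW t (S ++ S'.map Block.neg)
  simp only [simpleIntegral_append_neg, simpleIntegrand_append_neg] at this
  rw [eLpNorm_two_eq, eLpNorm_two_eq, ← this]
  rfl

end Isometry

/-! ### Comparison of `L²` distances through approximating sequences -/

theorem tendsto_eLpNorm_two_of_lintegral {β E : Type*} [MeasurableSpace β] [NormedAddCommGroup E]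
    {μ : Measure β} {f : ℕ → β → E}
    (h : Tendsto (fun n => ∫⁻ x, ‖f n x‖ₑ ^ 2 ∂μ) atTop (𝓝 0)) :
    Tendsto (fun n => eLpNorm (f n) 2 μ) atTop (𝓝 0) := by
  simp_rw [eLpNorm_two_eq]
  have := ((ENNReal.continuous_rpow_const (y := 1 / 2)).tendsto 0).comp h
  rw [ENNReal.zero_rpow_of_pos (by norm_num)] at this
  exact this

theorem eLpNorm_sub_le_add_sub_add {β E : Type*} [MeasurableSpace β] [NormedAddCommGroup E]
    {μ : Measure β} {f f' u u' : β → E} (hf : AEStronglyMeasurable f μ)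
    (hf' : AEStronglyMeasurable f' μ) (hu : AEStronglyMeasurable u μ)
    (hu' : AEStronglyMeasurable u' μ) :
    eLpNorm (f - f') 2 μ ≤ eLpNorm (f - u) 2 μ + eLpNorm (u - u') 2 μ + eLpNorm (f' - u') 2 μ := by
  have e : f - f' = ((f - u) + (u - u')) + (u' - f') := by abel
  rw [e, eLpNorm_sub_comm f' u']
  refine (eLpNorm_add_le ((hf.sub hu).add (hu.sub hu')) (hu'.sub hf') one_le_two).trans ?_
  gcongr
  exact eLpNorm_add_le (hf.sub hu) (hu.sub hu') one_le_two

/-- A distance in `L²` is at most another one, if this holds for approximating sequences. -/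
theorem eLpNorm_sub_le_of_tendsto {β γ E G : Type*} [MeasurableSpace β] [MeasurableSpace γ]
    [NormedAddCommGroup E] [NormedAddCommGroup G] {μ : Measure β} {ν : Measure γ} {f f' : β → E}
    {u u' : ℕ → β → E} {g g' : γ → G} {v v' : ℕ → γ → G} (hf : AEStronglyMeasurable f μ)
    (hf' : AEStronglyMeasurable f' μ) (hu : ∀ n, AEStronglyMeasurable (u n) μ)
    (hu' : ∀ n, AEStronglyMeasurable (u' n) μ) (hg : AEStronglyMeasurable g ν)
    (hg' : AEStronglyMeasurable g' ν) (hv : ∀ n, AEStronglyMeasurable (v n) ν)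
    (hv' : ∀ n, AEStronglyMeasurable (v' n) ν)
    (hfu : Tendsto (fun n => eLpNorm (f - u n) 2 μ) atTop (𝓝 0))
    (hfu' : Tendsto (fun n => eLpNorm (f' - u' n) 2 μ) atTop (𝓝 0))
    (hgv : Tendsto (fun n => eLpNorm (g - v n) 2 ν) atTop (𝓝 0))
    (hgv' : Tendsto (fun n => eLpNorm (g' - v' n) 2 ν) atTop (𝓝 0))
    (huv : ∀ n, eLpNorm (u n - u' n) 2 μ ≤ eLpNorm (v n - v' n) 2 ν) :
    eLpNorm (f - f') 2 μ ≤ eLpNorm (g - g') 2 ν := by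
  have hlim : Tendsto (fun n => eLpNorm (f - u n) 2 μ + (eLpNorm (g - v n) 2 ν
      + eLpNorm (g - g') 2 ν + eLpNorm (g' - v' n) 2 ν) + eLpNorm (f' - u' n) 2 μ) atTop
      (𝓝 (0 + (0 + eLpNorm (g - g') 2 ν + 0) + 0)) :=
    (hfu.add ((hgv.add tendsto_const_nhds).add hgv')).add hfu'
  simp only [zero_add, add_zero] at hlim
  refine ge_of_tendsto' hlim fun n => ?_
  refine (eLpNorm_sub_le_add_sub_add hf hf' (hu n) (hu' n)).trans ?_
  gcongr
  refine (huv n).trans ?_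
  rw [eLpNorm_sub_comm g (v n), eLpNorm_sub_comm g' (v' n)]
  exact eLpNorm_sub_le_add_sub_add (hv n) (hv' n) hg hg'

/-! ### Isometry and uniqueness for Itô integrals -/

section ItoUniqueness

variable {Ω : Type*} [mΩ : MeasurableSpace Ω] {Q : Measure Ω}
variable {H : Type*} [NormedAddCommGroup H] [InnerProductSpace ℝ H]

theorem aestronglyMeasurable_simpleIntegrand {𝓕 : Filtration ℝ≥0 mΩ} (S : List (Block 𝓕 H ℝ))
    (μ : Measure (ℝ≥0 × Ω)) :
    AEStronglyMeasurable (fun q => simpleIntegrand S q.1 q.2) μ := by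
  have hv : ∀ b : Block 𝓕 H ℝ, StronglyMeasurable b.vector := fun b =>
    ((((measurable_const.indicator measurableSet_Ioc).comp measurable_fst).stronglyMeasurable).mul
      ((b.measurable_coeff.mono (𝓕.le _)).comp_measurable measurable_snd)).smul_const _
  simp_rw [simpleIntegrand_eq_innerSL]
  exact ((innerSL ℝ).continuous.comp_stronglyMeasurable
    (Finset.stronglyMeasurable_fun_sum _ fun i _ => hv (S.get i))).aestronglyMeasurable

variable [IsFiniteMeasure Q] [CompleteSpace H] {W : ℝ≥0 → H → Ω → ℝ}

/-- The Itô isometry for differences of Itô integrals. -/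
theorem IsItoIntegral.eLpNorm_sub_eq (hW : IsCylindricalWiener W Q) {t : ℝ≥0}
    {α α' : ℝ≥0 → Ω → H →L[ℝ] ℝ} {Y Y' : Ω → ℝ}
    (h : IsItoIntegral (augFiltration W Q hW) W Q t α Y)
    (h' : IsItoIntegral (augFiltration W Q hW) W Q t α' Y') :
    eLpNorm (Y - Y') 2 Q
      = eLpNorm (Function.uncurry α - Function.uncurry α') 2 ((leb t).prod Q) := by
  obtain ⟨S, hSα, hSY⟩ := h.limit
  obtain ⟨S', hSα', hSY'⟩ := h'.limit
  simp only [hsNormSq_eq_enorm_sq] at hSα hSα'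
  have mα := aestronglyMeasurable_of_Iic h.measurable Q
  have mα' := aestronglyMeasurable_of_Iic h'.measurable Q
  have mS := fun n => aestronglyMeasurable_simpleIntegrand (S n) ((leb t).prod Q)
  have mS' := fun n => aestronglyMeasurable_simpleIntegrand (S' n) ((leb t).prod Q)
  have mI := fun n => (memLp_simpleIntegral hW t (S n)).1
  have mI' := fun n => (memLp_simpleIntegral hW t (S' n)).1
  have tα : Tendsto (fun n => eLpNorm (Function.uncurry α
      - fun q => simpleIntegrand (S n) q.1 q.2) 2 ((leb t).prod Q)) atTop (𝓝 0) :=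
    tendsto_eLpNorm_two_of_lintegral hSα
  have tα' : Tendsto (fun n => eLpNorm (Function.uncurry α'
      - fun q => simpleIntegrand (S' n) q.1 q.2) 2 ((leb t).prod Q)) atTop (𝓝 0) :=
    tendsto_eLpNorm_two_of_lintegral hSα'
  have tY : Tendsto (fun n => eLpNorm (Y - simpleIntegral W t (S n)) 2 Q) atTop (𝓝 0) :=
    tendsto_eLpNorm_two_of_lintegral hSY
  have tY' : Tendsto (fun n => eLpNorm (Y' - simpleIntegral W t (S' n)) 2 Q) atTop (𝓝 0) :=
    tendsto_eLpNorm_two_of_lintegral hSY'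
  have heq := fun n => eLpNorm_simpleIntegral_sub hW t (S n) (S' n)
  -- The isometry holds exactly along the approximations, so the limit comparison can be used in
  -- both directions.
  exact le_antisymm
    (eLpNorm_sub_le_of_tendsto h.aestronglyMeasurable h'.aestronglyMeasurable mI mI' mα mα' mS mS'
      tY tY' tα tα' fun n => (heq n).le)
    (eLpNorm_sub_le_of_tendsto mα mα' mS mS' h.aestronglyMeasurable h'.aestronglyMeasurable mI mI'
      tα tα' tY tY' fun n => (heq n).ge)

/-- Equal integrals are at distance zero, hence so are the integrands. This direction serves the
pre-hedging identity; the converse `IsItoIntegral.ae_eq` cancels the martingale parts of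
self-financing strategies. -/
theorem IsItoIntegral.ae_eq_integrand (hW : IsCylindricalWiener W Q) {t : ℝ≥0}
    {α α' : ℝ≥0 → Ω → H →L[ℝ] ℝ} {Y Y' : Ω → ℝ}
    (h : IsItoIntegral (augFiltration W Q hW) W Q t α Y)
    (h' : IsItoIntegral (augFiltration W Q hW) W Q t α' Y') (hY : Y =ᵐ[Q] Y') :
    ∀ᵐ q ∂(leb t).prod Q, α q.1 q.2 = α' q.1 q.2 := by
  have h0 := h.eLpNorm_sub_eq hW h'
  rw [eLpNorm_congr_ae hY.sub_eq, eLpNorm_zero] at h0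
  have hm : AEStronglyMeasurable (Function.uncurry α - Function.uncurry α') ((leb t).prod Q) :=
    (aestronglyMeasurable_of_Iic h.measurable Q).sub (aestronglyMeasurable_of_Iic h'.measurable Q)
  filter_upwards [(eLpNorm_eq_zero_iff hm two_ne_zero).1 h0.symm] with q hq
  exact sub_eq_zero.1 hq

theorem IsItoIntegral.ae_eq (hW : IsCylindricalWiener W Q) {t : ℝ≥0}
    {α α' : ℝ≥0 → Ω → H →L[ℝ] ℝ} {Y Y' : Ω → ℝ}
    (h : IsItoIntegral (augFiltration W Q hW) W Q t α Y)
    (h' : IsItoIntegral (augFiltration W Q hW) W Q t α' Y')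
    (hα : ∀ᵐ q ∂(leb t).prod Q, α q.1 q.2 = α' q.1 q.2) : Y =ᵐ[Q] Y' := by
  have h0 := h.eLpNorm_sub_eq hW h'
  have hm : AEStronglyMeasurable (Function.uncurry α - Function.uncurry α') ((leb t).prod Q) :=
    (aestronglyMeasurable_of_Iic h.measurable Q).sub (aestronglyMeasurable_of_Iic h'.measurable Q)
  rw [(eLpNorm_eq_zero_iff hm two_ne_zero).2 (by
    filter_upwards [hα] with q hq
    exact sub_eq_zero.2 hq)] at h0
  filter_upwards [(eLpNorm_eq_zero_iff (h.aestronglyMeasurable.sub h'.aestronglyMeasurable)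
    two_ne_zero).1 h0] with ω hω
  exact sub_eq_zero.1 hω

end ItoUniqueness

/-! ### Cutting functions at `t`, and functionals in both closed spans -/

section Cut

theorem MemF1.halfExt_min (x : ℝ≥0 → ℝ) (t : ℝ≥0) :
    halfExt (fun s => x (min s t)) = fun u => halfExt x (min u t) := by
  funext u
  simp only [halfExt]
  congr 1
  rw [← NNReal.coe_inj, NNReal.coe_min, Real.coe_toNNReal', Real.coe_toNNReal']
  have := NNReal.coe_nonneg t
  grind

/-- A function of the first-order space that vanishes at `t`, stopped at `t`. -/
theorem MemF1.min {v : Weight} {x : ℝ≥0 → ℝ} (hx : MemF1 v x) {t : ℝ≥0} (ht : x t = 0) :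
    MemF1 v fun s => x (min s t) := by
  refine ⟨fun b => ?_, ?_, ?_⟩
  · rw [MemF1.halfExt_min, absolutelyContinuousOnInterval_iff]
    intro ε hε
    obtain ⟨δ, hδ, h⟩ := (absolutelyContinuousOnInterval_iff _ _ _).1 (hx.ac b) ε hε
    refine ⟨δ, hδ, fun E hE hEδ => ?_⟩
    -- Clipping endpoints at `t` replaces each interval by a possibly empty subinterval, which
    -- preserves disjointness and does not increase the total length.
    refine h (E.1, fun i => (Min.min (E.2 i).1 t, Min.min (E.2 i).2 t)) ⟨fun i hi => ?_, ?_⟩ ?_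
    · have := hE.1 i hi
      simp only [uIcc_of_le (NNReal.coe_nonneg b), mem_Icc] at this ⊢
      have := NNReal.coe_nonneg t
      grind
    · refine hE.2.mono fun i => ?_
      intro u
      simp only [uIoc, mem_Ioc]
      grind
    · refine lt_of_le_of_lt (Finset.sum_le_sum fun i _ => ?_) hEδ
      simp only [Real.dist_eq]
      exact abs_min_sub_min_le_max _ _ _ _ |>.trans (by simp)
  · refine tendsto_const_nhds.congr' ?_
    filter_upwards [eventually_ge_atTop t] with s hs
    rw [min_eq_right hs, ht]
  · refine hx.memLp.mono (measurable_deriv _).aestronglyMeasurable ?_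
    -- The stopped function may have a kink at `t`, which is a null point.
    have hne : ∀ᵐ u ∂v.measure, u ≠ (t : ℝ) := by
      refine (measure_ac v).ae_le (ae_restrict_of_ae ?_)
      simp [ae_iff]
    filter_upwards [hne] with u hu
    rw [MemF1.halfExt_min]
    rcases lt_or_gt_of_ne hu with h | h
    · have : (fun u => halfExt x (Min.min u t)) =ᶠ[𝓝 u] halfExt x := by
        filter_upwards [Iio_mem_nhds h] with r hr
        rw [min_eq_left (le_of_lt hr)]
      rw [this.deriv_eq]
    · have : (fun u => halfExt x (Min.min u t)) =ᶠ[𝓝 u] fun _ => halfExt x t := by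
        filter_upwards [Ioi_mem_nhds h] with r hr
        rw [min_eq_right (le_of_lt hr)]
      rw [this.deriv_eq, deriv_const, norm_zero]
      exact norm_nonneg _

namespace WeightPair

variable {p : WeightPair}

theorem apply_eq_zero_of_mem_closedSpan {A : Set ℝ≥0} {φ : p.Fdual} (hφ : φ ∈ p.closedSpan A)
    {x : F1 p.v} (hx : ∀ s ∈ A, x.1 s = 0) : φ x = 0 := by
  set K : Submodule ℝ p.Fdual :=
    LinearMap.ker (ContinuousLinearMap.apply ℝ ℝ x : p.Fdual →L[ℝ] ℝ).toLinearMap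
  have hK : IsClosed (K : Set p.Fdual) :=
    (ContinuousLinearMap.apply ℝ ℝ x : p.Fdual →L[ℝ] ℝ).isClosed_ker
  have h : p.closedSpan A ≤ K := by
    refine Submodule.topologicalClosure_minimal _ (Submodule.span_le.2 ?_) hK
    rintro _ ⟨s, hs, rfl⟩
    exact hx s hs
  exact h hφ

/-- A functional in the closed spans of the evaluations before `t` and of those after `t` is a
multiple of the evaluation at `t`. -/
theorem exists_eq_smul_δ {t : ℝ≥0} {φ : p.Fdual} (h₁ : φ ∈ p.closedSpan (Icc 0 t))
    (h₂ : φ ∈ p.closedSpan (Ici t)) : ∃ c : ℝ, φ = c • p.δ t := by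
  have hker : ∀ x : F1 p.v, p.δ t x = 0 → φ x = 0 := by
    intro x hx
    have ht : x.1 t = 0 := hx
    -- `y` vanishes from `t` on and `x - y` vanishes up to `t`, so each is killed by one of the two
    -- memberships.
    set y : F1 p.v := ⟨fun s => x.1 (min s t), x.2.min ht⟩ with hy
    have e1 : φ y = 0 := apply_eq_zero_of_mem_closedSpan h₂ fun s hs => by
      rw [hy]
      change x.1 (min s t) = 0
      rw [min_eq_right hs, ht]
    have e2 : φ (x - y) = 0 := apply_eq_zero_of_mem_closedSpan h₁ fun s hs => by
      change x.1 s - x.1 (min s t) = 0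
      rw [min_eq_left hs.2, sub_self]
    rwa [map_sub, e1, sub_zero] at e2
  -- A functional vanishing on the kernel of `δ_t` is a multiple of `δ_t`. If `δ_t` were zero, so
  -- would be `φ`, which makes it unnecessary to show `δ_t ≠ 0`.
  by_cases h0 : ∃ y, p.δ t y ≠ 0
  · obtain ⟨y, hy⟩ := h0
    refine ⟨φ y / p.δ t y, ContinuousLinearMap.ext fun x => ?_⟩
    have h := hker (x - (p.δ t x / p.δ t y) • y) (by
      rw [map_sub, map_smul, smul_eq_mul, div_mul_cancel₀ _ hy, sub_self])
    rw [map_sub, map_smul, sub_eq_zero] at h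
    rw [h, smul_apply, smul_eq_mul, smul_eq_mul]
    ring
  · push Not at h0
    exact ⟨0, ContinuousLinearMap.ext fun x => by rw [hker x (h0 x)]; simp⟩

end WeightPair

end Cut

/-! ### Backward Grönwall inequality -/

section Gronwall

/-- Grönwall's inequality backwards in time, for measures. -/
theorem measure_Ioi_zero_eq_zero {ρ ν : Measure ℝ≥0} [IsFiniteMeasure ρ] [IsFiniteMeasure ν]
    [NullSingletonClass ν] {T : ℝ≥0} (hT : ρ (Ioi T) = 0)
    (h : ∀ s t, s < t → ρ (Ioc s t) ≤ ρ (Ioi s) * ν (Ioc s t)) : ρ (Ioi 0) = 0 := by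
  -- `t₀` is the first time after which `ρ` has no mass. The infimum is attained, and the aim is `t₀
  -- = 0`.
  set A : Set ℝ≥0 := {t | ρ (Ioi t) = 0} with hA
  set t₀ := sInf A
  have ht₀ : ρ (Ioi t₀) = 0 := by
    obtain ⟨u, -, hu, hlim⟩ := exists_seq_strictAnti_tendsto t₀
    refine measure_mono_null (t := ⋃ n, Ioi (u n)) (fun s hs => ?_)
      (measure_iUnion_null fun n => ?_)
    · obtain ⟨n, hn⟩ := (hlim.eventually_lt_const hs).exists
      exact mem_iUnion.2 ⟨n, hn⟩
    · obtain ⟨a, ha, han⟩ := exists_lt_of_csInf_lt ⟨T, hT⟩ (hu n)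
      exact measure_mono_null (Ioi_subset_Ioi han.le) ha
  rcases eq_zero_or_pos t₀ with h0 | h0
  · rwa [h0] at ht₀
  obtain ⟨u, humono, hu, hlim⟩ := exists_seq_strictMono_tendsto' h0
  have hinter : ⋂ n, Ioc (u n) t₀ = {t₀} := by
    ext s
    simp only [mem_iInter, mem_Ioc, mem_singleton_iff]
    refine ⟨fun hs => le_antisymm (hs 0).2 (le_of_tendsto' hlim fun n => (hs n).1.le), ?_⟩
    rintro rfl n
    exact ⟨(hu n).2, le_rfl⟩
  -- Without an atom at `t₀`, `ν` has mass below 1 on a short interval ending at `t₀`. There the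
  -- hypothesis reads `m ≤ m * θ` with `θ < 1` and `m` finite, so `m = 0`, against the minimality of
  -- `t₀`.
  have hν : Tendsto (fun n => ν (Ioc (u n) t₀)) atTop (𝓝 0) := by
    have := tendsto_measure_iInter_atTop (μ := ν) (s := fun n => Ioc (u n) t₀)
      (fun n => measurableSet_Ioc.nullMeasurableSet)
      (fun m n hmn => Ioc_subset_Ioc_left (humono.monotone hmn)) ⟨0, measure_ne_top _ _⟩
    rwa [hinter, measure_singleton] at this
  obtain ⟨n, hn⟩ := (hν.eventually_lt_const one_pos).exists
  have hle : ρ (Ioi (u n)) ≤ ρ (Ioi (u n)) * ν (Ioc (u n) t₀) := by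
    calc ρ (Ioi (u n)) ≤ ρ (Ioc (u n) t₀) + ρ (Ioi t₀) := by
          rw [← Ioc_union_Ioi_eq_Ioi (hu n).2.le]; exact measure_union_le _ _
      _ ≤ _ := by rw [ht₀, add_zero]; exact h _ _ (hu n).2
  have hmem : u n ∈ A := by
    by_contra hne
    have hlt := ENNReal.mul_lt_mul_right hne (measure_ne_top ρ _) hn
    rw [mul_one] at hlt
    exact absurd hle (not_le.2 hlt)
  exact absurd (csInf_le (OrderBot.bddBelow A) hmem) (not_le.2 (hu n).2)

/-- A solution of a linear differential equation that vanishes at the final time vanishes. -/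
theorem ae_eq_zero_of_enorm_le_lintegral {μ : Measure ℝ≥0} [NullSingletonClass μ] {T : ℝ≥0}
    (hT : ∀ᵐ s ∂μ, s ≤ T) {D g : ℝ≥0 → ℝ} {k : ℝ≥0 → ℝ≥0∞} (hg : Integrable g μ)
    (hk : ∫⁻ s, k s ∂μ ≠ ∞) (hgk : ∀ s, ‖g s‖ₑ ≤ k s * ‖D s‖ₑ)
    (hD : ∀ᵐ t ∂μ, ‖D t‖ₑ ≤ ∫⁻ s in Ioi t, ‖g s‖ₑ ∂μ) : ∀ᵐ t ∂μ, D t = 0 := by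
  -- The bound on `D` holds only almost everywhere, so the argument runs on the measures with
  -- densities `|g|` and `k` and asks no continuity of `D`.
  set ρ := μ.withDensity fun s => ‖g s‖ₑ
  set ν := μ.withDensity k
  have : IsFiniteMeasure ρ := isFiniteMeasure_withDensity hg.2.ne
  have : IsFiniteMeasure ν := isFiniteMeasure_withDensity hk
  have : NullSingletonClass ν :=
    ⟨fun x => withDensity_absolutelyContinuous _ _ (measure_singleton x)⟩
  have hρ : ∀ t, ρ (Ioi t) = ∫⁻ s in Ioi t, ‖g s‖ₑ ∂μ := fun t =>
    withDensity_apply _ measurableSet_Ioi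
  have h0 : ρ (Ioi 0) = 0 := by
    refine measure_Ioi_zero_eq_zero (ν := ν) (T := T) ?_ fun s t hst => ?_
    · refine withDensity_absolutelyContinuous _ _ (measure_mono_null (fun s hs => ?_) hT)
      exact not_le.2 (mem_Ioi.1 hs)
    · rw [withDensity_apply _ measurableSet_Ioc, withDensity_apply _ measurableSet_Ioc, mul_comm,
        ← lintegral_mul_const' _ _ (measure_ne_top ρ _)]
      refine lintegral_mono_ae ?_
      filter_upwards [ae_restrict_of_ae hD, ae_restrict_mem measurableSet_Ioc] with r hr hrs
      refine (hgk r).trans (mul_le_mul' le_rfl (hr.trans ?_))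
      rw [← hρ]
      exact measure_mono (Ioi_subset_Ioi hrs.1.le)
  filter_upwards [hD] with t ht
  rw [← hρ, measure_mono_null (Ioi_subset_Ioi (zero_le (a := t))) h0] at ht
  simpa using ht

end Gronwall

/-! ### Continuity of evaluations and measurability along the diagonal -/

section Measurability

theorem MemF1.continuous {v : Weight} {x : ℝ≥0 → ℝ} (hx : MemF1 v x) : Continuous x := by
  refine continuous_iff_continuousAt.2 fun s => ?_
  have hs := NNReal.coe_nonneg s
  have h := (hx.ac (s + 1)).continuousOn
  rw [uIcc_of_le (NNReal.coe_nonneg _)] at h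
  have h1 := h s ⟨hs, by push_cast; linarith⟩
  have h2 : Tendsto (fun r : ℝ≥0 => (r : ℝ)) (𝓝 s) (𝓝[Icc 0 ((s + 1 : ℝ≥0) : ℝ)] (s : ℝ)) := by
    refine tendsto_nhdsWithin_iff.2 ⟨NNReal.continuous_coe.tendsto s, ?_⟩
    filter_upwards [eventually_le_nhds (show s < s + 1 by simp)] with r hr
    exact ⟨NNReal.coe_nonneg r, NNReal.coe_le_coe.2 hr⟩
  have h3 := h1.tendsto.comp h2
  simpa only [ContinuousAt, Function.comp_def, halfExt_coe] using h3

theorem WeightPair.continuous_rderiv_apply (p : WeightPair) (s : ℝ≥0) :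
    Continuous fun x : F2 p.w => rderiv x.1 s := by
  set K := ∫⁻ u in Ioi (0 : ℝ), ENNReal.ofReal (p.w.toFun u.toNNReal)⁻¹
  have hK : K < ∞ := by
    -- Since `1 ≤ 1 + u²`, the condition on `w` dominates the integral of `1 / w`.
    refine lt_of_le_of_lt (lintegral_mono fun u => ENNReal.ofReal_le_ofReal ?_) p.finite_w
    have := (p.w.pos u.toNNReal).le
    exact le_mul_of_one_le_left (by positivity) (by nlinarith [sq_nonneg u])
  set L : F2 p.w →ₗ[ℝ] ℝ :=
    { toFun := fun x => rderiv x.1 s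
      map_add' := fun x y => congrFun (rderiv_add x.2.diff y.2.diff) s
      map_smul' := fun c x => congrFun (rderiv_smul c x.2.diff) s }
  refine AddMonoidHomClass.continuous_of_bound L (√K.toReal) fun x => ?_
  have h : ‖rderiv x.1 s‖ₑ ^ 2 ≤ K * ‖‖x‖‖ₑ ^ 2 := by
    have hx : eLpNorm (deriv (halfExt (rderiv x.1))) 2 p.w.measure = ‖x‖ₑ :=
      (F1.enorm_eq p.w (F2.D p.w x)).symm
    rw [enorm_norm, ← hx]
    exact (x.2.memF1.enorm_sq_le s).trans
      (mul_le_mul' (lintegral_mono_set (Ioi_subset_Ioi s.2)) le_rfl)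
  have h' := WeightPair.enorm_le_of_sq_le hK h
  rwa [norm_norm] at h'

variable {p : WeightPair} {Ω : Type*} [mΩ : MeasurableSpace Ω]

/-- A function continuous in the maturity and measurable in the remaining variables is jointly
measurable; the maturity is then set equal to the current time. -/
theorem stronglyMeasurable_eval {X : ℝ≥0 × Ω → F2 p.w} (hX : StronglyMeasurable X) :
    StronglyMeasurable fun q : ℝ≥0 × Ω => (X q).1 q.1 := by
  have h := stronglyMeasurable_uncurry_of_continuous_of_stronglyMeasurable
    (u := fun (s : ℝ≥0) (q : ℝ≥0 × Ω) => (X q).1 s) (fun q => (p.memF1 (X q)).continuous)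
    (fun s => ((p.δ s).comp p.incl).continuous.comp_stronglyMeasurable hX)
  exact h.comp_measurable (measurable_fst.prodMk measurable_id)

theorem stronglyMeasurable_rderiv {X : ℝ≥0 × Ω → F2 p.w} (hX : StronglyMeasurable X) :
    StronglyMeasurable fun q : ℝ≥0 × Ω => rderiv (X q).1 q.1 := by
  have h := stronglyMeasurable_uncurry_of_continuous_of_stronglyMeasurable
    (u := fun (s : ℝ≥0) (q : ℝ≥0 × Ω) => rderiv (X q).1 s) (fun q => (X q).2.memF1.continuous)
    (fun s => (p.continuous_rderiv_apply s).comp_stronglyMeasurable hX)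
  exact h.comp_measurable (measurable_fst.prodMk measurable_id)

theorem WeightPair.exists_abs_apply_le (p : WeightPair) :
    ∃ C : ℝ, 0 ≤ C ∧ ∀ (x : F2 p.w) (s : ℝ≥0), |x.1 s| ≤ C * ‖x‖ := by
  set K := √(∫⁻ u in Ioi (0 : ℝ), ENNReal.ofReal (p.v.toFun u.toNNReal)⁻¹).toReal
  refine ⟨K * ‖p.incl‖, by positivity, fun x s => ?_⟩
  have h1 : ‖p.δ s‖ ≤ K := LinearMap.mkContinuous_norm_le _ (Real.sqrt_nonneg _) _
  calc |x.1 s| = ‖p.δ s (p.incl x)‖ := rfl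
    _ ≤ ‖p.δ s‖ * ‖p.incl x‖ := (p.δ s).le_opNorm _
    _ ≤ K * (‖p.incl‖ * ‖x‖) :=
      mul_le_mul h1 (p.incl.le_opNorm x) (norm_nonneg _) (Real.sqrt_nonneg _)
    _ = K * ‖p.incl‖ * ‖x‖ := by ring

end Measurability

/-! ### Values of self-financing strategies -/

section Market

variable {Ω : Type*} {p : WeightPair} {H : Type*} [NormedAddCommGroup H] [InnerProductSpace ℝ H]

/-- The drift is a scalar multiple of the price curve, which is what makes the equation for the
value difference linear and homogeneous. -/
theorem apply_bondDrift (P : ℝ≥0 → Ω → F2 p.w) (ψ : p.Fdual) (t : ℝ≥0) (ω : Ω) :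
    ψ (p.incl (bondDrift P t ω))
      = -(rderiv (P t ω).1 t / (P t ω).1 t) * ψ (p.incl (bondPrice P t ω)) := by
  simp only [bondDrift, bondPrice, map_smul, smul_eq_mul]
  ring

theorem adj_bondVol (P : ℝ≥0 → Ω → F2 p.w) (σ : ℝ≥0 → Ω → H →L[ℝ] F2 p.w) (ψ : p.Fdual)
    (t : ℝ≥0) (ω : Ω) :
    p.adj (bondVol P σ t ω) ψ = ((P t ω).1 t)⁻¹ • p.adj (σ t ω) ψ := by
  ext x
  simp [WeightPair.adj, bondVol]

variable [mΩ : MeasurableSpace Ω] {Q : Measure Ω} {P : ℝ≥0 → Ω → F2 p.w} {σ : ℝ≥0 → Ω → H →L[ℝ] F2 p.w}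

theorem ae_prod_of_forall_ae {α : Type*} [MeasurableSpace α] {μ : Measure α} [SFinite μ]
    [SFinite Q] {r : α × Ω → Prop} (hr : MeasurableSet {q | r q})
    (h : ∀ᵐ a ∂μ, ∀ᵐ ω ∂Q, r (a, ω)) : ∀ᵐ q ∂μ.prod Q, r q :=
  (Measure.ae_prod_iff_ae_ae hr).2 h

theorem stronglyMeasurable_bondPrice (hP : StronglyMeasurable (Function.uncurry P)) :
    StronglyMeasurable (Function.uncurry (bondPrice P)) :=
  (stronglyMeasurable_eval hP).measurable.inv.stronglyMeasurable.smul hP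

theorem stronglyMeasurable_bondDrift (hP : StronglyMeasurable (Function.uncurry P)) :
    StronglyMeasurable (Function.uncurry (bondDrift P)) :=
  ((stronglyMeasurable_rderiv hP).measurable.div
    ((stronglyMeasurable_eval hP).measurable.pow_const 2)).neg.stronglyMeasurable.smul hP

theorem stronglyMeasurable_pairing {ψ : ℝ≥0 → Ω → p.Fdual} {X : ℝ≥0 → Ω → F2 p.w}
    (hψ : StronglyMeasurable (Function.uncurry ψ)) (hX : StronglyMeasurable (Function.uncurry X)) :
    StronglyMeasurable fun q : ℝ≥0 × Ω => ψ q.1 q.2 (p.incl (X q.1 q.2)) :=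
  isBoundedBilinearMap_apply.continuous.comp_stronglyMeasurable
    (hψ.prodMk (p.incl.continuous.comp_stronglyMeasurable hX))

/-- The time integral of a jointly measurable process is jointly measurable. -/
theorem stronglyMeasurable_integral_leb {g : ℝ≥0 × Ω → ℝ} (hg : StronglyMeasurable g)
    (T : ℝ≥0) : StronglyMeasurable fun q : ℝ≥0 × Ω => ∫ s in Iic q.1, g (s, q.2) ∂leb T := by
  have h : StronglyMeasurable (Function.uncurry fun (q : ℝ≥0 × Ω) (s : ℝ≥0) =>
      (Iic q.1).indicator (fun s => g (s, q.2)) s) := by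
    have h1 : StronglyMeasurable fun z : (ℝ≥0 × Ω) × ℝ≥0 => g (z.2, z.1.2) :=
      hg.comp_measurable (measurable_snd.prodMk (measurable_snd.comp measurable_fst))
    exact h1.indicator (s := {z | z.2 ≤ z.1.1})
      (measurableSet_le measurable_snd (measurable_fst.comp measurable_fst))
  have h2 := h.integral_prod_right (ν := leb T)
  simpa only [integral_indicator measurableSet_Iic] using h2

variable [CompleteSpace H] {W : ℝ≥0 → H → Ω → ℝ} {𝓕 : Filtration ℝ≥0 mΩ}

theorem IsBondModel.ae_eval_pos [IsFiniteMeasure Q] (hP : IsBondModel p 𝓕 W Q P σ) (T : ℝ≥0) :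
    ∀ᵐ q ∂(leb T).prod Q, 0 < (P q.1 q.2).1 q.1 :=
  ae_prod_of_forall_ae
    (measurableSet_lt measurable_const (stronglyMeasurable_eval hP.measurable_P).measurable)
    (ae_of_all _ fun t => (hP.positive t).mono fun _ h => h t)

/-- The short rate is integrable along almost every path. -/
theorem IsBondModel.ae_lintegral_shortRate_lt_top [IsFiniteMeasure Q]
    (hP : IsBondModel p 𝓕 W Q P σ) (T : ℝ≥0) :
    ∀ᵐ ω ∂Q, ∫⁻ s, ‖rderiv (P s ω).1 s / (P s ω).1 s‖ₑ ∂leb T < ∞ := by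
  obtain ⟨C, hC, hCP⟩ := p.exists_abs_apply_le
  have hm : Measurable fun q : ℝ≥0 × Ω =>
      ‖rderiv (P q.1 q.2).1 q.1 / (P q.1 q.2).1 q.1‖ₑ :=
    ((stronglyMeasurable_rderiv hP.measurable_P).measurable.div
      (stronglyMeasurable_eval hP.measurable_P).measurable).enorm
  have hlt : ∫⁻ q, ‖rderiv (P q.1 q.2).1 q.1 / (P q.1 q.2).1 q.1‖ₑ ∂(leb T).prod Q < ∞ := by
    -- From `0 < P_s(s) ≤ C ‖P_s‖` follows `|P_s'(s)| / P_s(s) ≤ C |P_s'(s)| ‖P_s‖ / P_s(s)²`, a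
    -- multiple of the first term in the model's integrability condition.
    refine lt_of_le_of_lt (b := ∫⁻ q, ENNReal.ofReal C * (ENNReal.ofReal
      (|rderiv (P q.1 q.2) q.1| * ‖P q.1 q.2‖ / (P q.1 q.2 q.1) ^ 2)
      + ENNReal.ofReal (1 + 1 / (P q.1 q.2 q.1) ^ 2) * hsNormSq (σ q.1 q.2)) ∂(leb T).prod Q)
      (lintegral_mono_ae ?_) ?_
    · filter_upwards [hP.ae_eval_pos T] with q hq
      refine le_trans ?_ (mul_le_mul' le_rfl le_self_add)
      rw [← ENNReal.ofReal_mul hC, ← ofReal_norm]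
      refine ENNReal.ofReal_le_ofReal ?_
      have h := hCP (P q.1 q.2) q.1
      rw [abs_of_pos hq] at h
      rw [norm_div, Real.norm_eq_abs, Real.norm_eq_abs, abs_of_pos hq, ← mul_div_assoc,
        div_le_div_iff₀ hq (by positivity)]
      have h0 := abs_nonneg (rderiv (P q.1 q.2).1 q.1)
      nlinarith [mul_nonneg (mul_nonneg h0 hq.le) (sub_nonneg.2 h)]
    · rw [lintegral_const_mul' _ _ ENNReal.ofReal_ne_top]
      exact ENNReal.mul_lt_top ENNReal.ofReal_lt_top (hP.integrable T)
  rw [lintegral_prod_symm _ hm.aemeasurable] at hlt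
  exact ae_lt_top hm.lintegral_prod_left' hlt.ne

variable [IsFiniteMeasure Q]

theorem IsPreHedging.ae_adj_eq (hW : IsCylindricalWiener W Q) {T : ℝ≥0} {ξ : Ω → ℝ}
    {φ₁ φ₂ : ℝ≥0 → Ω → p.Fdual} (h₁ : IsPreHedging (augFiltration W Q hW) W Q P σ T ξ φ₁)
    (h₂ : IsPreHedging (augFiltration W Q hW) W Q P σ T ξ φ₂) :
    ∀ᵐ q ∂(leb T).prod Q, p.adj (σ q.1 q.2) (φ₁ q.1 q.2) = p.adj (σ q.1 q.2) (φ₂ q.1 q.2) :=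
  h₁.represents.2.ae_eq_integrand hW h₂.represents.2 (ae_of_all _ fun ω => by simp)

/-- Strategies with the same martingale part have values whose difference has a drift only. -/
theorem IsSelfFinancing.ae_sub_eq (hW : IsCylindricalWiener W Q) {T : ℝ≥0}
    {φ₁ φ₂ : ℝ≥0 → Ω → p.Fdual} (h₁ : IsSelfFinancing (augFiltration W Q hW) W Q P σ T φ₁)
    (h₂ : IsSelfFinancing (augFiltration W Q hW) W Q P σ T φ₂)
    (hadj : ∀ᵐ q ∂(leb T).prod Q,
      p.adj (σ q.1 q.2) (φ₁ q.1 q.2) = p.adj (σ q.1 q.2) (φ₂ q.1 q.2)) {t : ℝ≥0} (ht : t ≤ T) :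
    ∀ᵐ ω ∂Q, Integrable (fun s => (φ₁ s ω - φ₂ s ω) (p.incl (bondDrift P s ω))) (leb t) ∧
      (φ₁ t ω - φ₂ t ω) (p.incl (bondPrice P t ω)) - (φ₁ 0 ω - φ₂ 0 ω) (p.incl (bondPrice P 0 ω))
        = ∫ s, (φ₁ s ω - φ₂ s ω) (p.incl (bondDrift P s ω)) ∂leb t := by
  have hac : (leb t).prod Q ≪ (leb T).prod Q :=
    (leb_le ht).absolutelyContinuous.prod Measure.AbsolutelyContinuous.rfl
  have hvol : ∀ᵐ q ∂(leb t).prod Q, p.adj (bondVol P σ q.1 q.2) (φ₁ q.1 q.2)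
      = p.adj (bondVol P σ q.1 q.2) (φ₂ q.1 q.2) := by
    filter_upwards [hac.ae_le hadj] with q hq
    rw [adj_bondVol, adj_bondVol, hq]
  filter_upwards [(h₁.selfFinancing t ht).1, (h₂.selfFinancing t ht).1,
    (h₁.selfFinancing t ht).2.ae_eq hW (h₂.selfFinancing t ht).2 hvol] with ω i₁ i₂ h
  refine ⟨i₁.sub i₂, ?_⟩
  simp only [sub_apply]
  rw [integral_sub i₁ i₂]
  simp only [portfolioValue] at h
  linarith

/-- Two self-financing strategies with the same martingale part and the same final value have the
same value at almost every time. -/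
theorem IsSelfFinancing.ae_value_sub_eq_zero (hW : IsCylindricalWiener W Q)
    (hP : IsBondModel p (augFiltration W Q hW) W Q P σ) {T : ℝ≥0}
    {φ₁ φ₂ : ℝ≥0 → Ω → p.Fdual} (h₁ : IsSelfFinancing (augFiltration W Q hW) W Q P σ T φ₁)
    (h₂ : IsSelfFinancing (augFiltration W Q hW) W Q P σ T φ₂)
    (hadj : ∀ᵐ q ∂(leb T).prod Q,
      p.adj (σ q.1 q.2) (φ₁ q.1 q.2) = p.adj (σ q.1 q.2) (φ₂ q.1 q.2))
    (hT : ∀ᵐ ω ∂Q, portfolioValue P φ₁ T ω = portfolioValue P φ₂ T ω) :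
    ∀ᵐ q ∂(leb T).prod Q, (φ₁ q.1 q.2 - φ₂ q.1 q.2) (p.incl (bondPrice P q.1 q.2)) = 0 := by
  obtain ⟨β₁, hβ₁, e₁⟩ := exists_stronglyMeasurable_eq_of_le h₁.measurable
  obtain ⟨β₂, hβ₂, e₂⟩ := exists_stronglyMeasurable_eq_of_le h₂.measurable
  set ψ : ℝ≥0 → Ω → p.Fdual := fun s ω => β₁ s ω - β₂ s ω with hψ_def
  have hψ : StronglyMeasurable (Function.uncurry ψ) := hβ₁.sub hβ₂
  have e : ∀ s ≤ T, ∀ ω, φ₁ s ω - φ₂ s ω = ψ s ω := fun s hs ω => by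
    rw [hψ_def, ← e₁ s hs, ← e₂ s hs]
  have hD := stronglyMeasurable_pairing hψ (stronglyMeasurable_bondPrice hP.measurable_P)
  have hg := stronglyMeasurable_pairing hψ (stronglyMeasurable_bondDrift hP.measurable_P)
  set D : ℝ≥0 × Ω → ℝ := fun q => ψ q.1 q.2 (p.incl (bondPrice P q.1 q.2)) with hD_def
  set g : ℝ≥0 × Ω → ℝ := fun q => ψ q.1 q.2 (p.incl (bondDrift P q.1 q.2)) with hg_def
  have hsf : ∀ t ≤ T, ∀ᵐ ω ∂Q, Integrable (fun s => g (s, ω)) (leb t) ∧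
      D (t, ω) - D (0, ω) = ∫ s in Iic t, g (s, ω) ∂leb T := by
    intro t ht
    filter_upwards [h₁.ae_sub_eq hW h₂ hadj ht] with ω hω
    rw [e t ht, e 0 zero_le] at hω
    have hae : (fun s => (φ₁ s ω - φ₂ s ω) (p.incl (bondDrift P s ω))) =ᵐ[leb t]
        fun s => g (s, ω) := by
      filter_upwards [ae_leb_le t] with s hs
      rw [e s (hs.trans ht)]
    rw [leb_restrict_Iic ht, ← integral_congr_ae hae]
    exact ⟨hω.1.congr hae, hω.2⟩
  -- The exceptional null set in `hsf` depends on `t`. Fubini's theorem exchanges the quantifiers,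
  -- at the cost of losing a null set of times on each path.
  have hpath : ∀ᵐ ω ∂Q, ∀ᵐ t ∂leb T, D (t, ω) - D (0, ω) = ∫ s in Iic t, g (s, ω) ∂leb T := by
    have hm : MeasurableSet {q : ℝ≥0 × Ω |
        D q - D (0, q.2) = ∫ s in Iic q.1, g (s, q.2) ∂leb T} :=
      measurableSet_eq_fun
        (hD.measurable.sub (hD.measurable.comp (measurable_const.prodMk measurable_snd)))
        (stronglyMeasurable_integral_leb hg T).measurable
    refine (Measure.ae_ae_comm (μ := leb T) (ν := Q) (p := fun t ω =>
      D (t, ω) - D (0, ω) = ∫ s in Iic t, g (s, ω) ∂leb T) hm).1 ?_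
    filter_upwards [ae_leb_le T] with t ht
    exact (hsf t ht).mono fun ω h => h.2
  have hzero : ∀ᵐ ω ∂Q, ∀ᵐ t ∂leb T, D (t, ω) = 0 := by
    filter_upwards [hpath, hsf T le_rfl, hT, hP.ae_lintegral_shortRate_lt_top T]
      with ω hω hωT hrep hk
    have hDT : D (T, ω) = 0 := by
      rw [hD_def]
      change ψ T ω (p.incl (bondPrice P T ω)) = 0
      rw [← e T le_rfl, sub_apply, sub_eq_zero]
      exact hrep
    have hint := hωT.1
    have h0 := hωT.2
    rw [leb_restrict_Iic le_rfl] at h0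
    -- The rate `k` is the absolute value of the short rate, whose integrability along the path is
    -- `hk`.
    refine ae_eq_zero_of_enorm_le_lintegral (ae_leb_le T) (g := fun s => g (s, ω)) hint hk.ne
      (fun s => ?_) ?_
    · rw [hg_def, hD_def]
      simp only
      rw [apply_bondDrift, enorm_mul, enorm_neg]
    · filter_upwards [hω] with t ht
      -- Subtracting the identity at `t` from the one at `T`, where `D` vanishes, eliminates the
      -- unknown initial value.
      have hsplit := integral_add_compl (measurableSet_Iic (a := t)) hint
      rw [compl_Iic] at hsplit
      have hDt : D (t, ω) = -∫ s in Ioi t, g (s, ω) ∂leb T := by linarith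
      rw [hDt, enorm_neg]
      exact enorm_integral_le_lintegral_enorm _
  have hprod : ∀ᵐ q ∂(leb T).prod Q, D q = 0 := by
    have hm : MeasurableSet {q : ℝ≥0 × Ω | D q = 0} :=
      measurableSet_eq_fun hD.measurable measurable_const
    exact ae_prod_of_forall_ae hm ((Measure.ae_ae_comm hm).2 hzero)
  filter_upwards [hprod, ae_leb_prod_le T Q] with q hq hqT
  rw [e q.1 hqT]
  exact hq

end Market

end BondMarket

theorem proposition3p7 {Ω : Type*} [MeasurableSpace Ω] (Q : Measure Ω) [IsProbabilityMeasure Q]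
    [Q.IsComplete] {H : Type*} [NormedAddCommGroup H] [InnerProductSpace ℝ H] [CompleteSpace H]
    [TopologicalSpace.SeparableSpace H] (p : WeightPair)
    (W : ℝ≥0 → H → Ω → ℝ) (hW : IsCylindricalWiener W Q)
    (P : ℝ≥0 → Ω → F2 p.w) (σ : ℝ≥0 → Ω → H →L[ℝ] F2 p.w)
    (hP : IsBondModel p (augFiltration W Q hW) W Q P σ) (T : ℝ≥0)
    (hker : ∀ᵐ q ∂(leb T).prod Q,
      (p.adj (σ q.1 q.2)).toLinearMap.ker = p.closedSpan (Icc 0 q.1))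
    (ξ : Ω → ℝ) (hξ : StronglyMeasurable[augFiltration W Q hW T] ξ)
    (φ₁ φ₂ : ℝ≥0 → Ω → p.Fdual)
    (h₁ : IsHedging (augFiltration W Q hW) W Q P σ T ξ φ₁)
    (h₂ : IsHedging (augFiltration W Q hW) W Q P σ T ξ φ₂) :
    ∀ᵐ q ∂(leb T).prod Q, φ₁ q.1 q.2 = φ₂ q.1 q.2 := by
  have hadj := h₁.preHedging.ae_adj_eq hW h₂.preHedging
  have hval := h₁.selfFinancing.ae_value_sub_eq_zero hW hP h₂.selfFinancing hadj (by
    filter_upwards [h₁.replicates, h₂.replicates] with ω e₁ e₂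
    rw [e₁, e₂])
  filter_upwards [hadj, hval, hker, hP.ae_eval_pos T, h₁.selfFinancing.mem, h₂.selfFinancing.mem]
    with q hq hqval hqker hqpos m₁ m₂
  have hmem : φ₁ q.1 q.2 - φ₂ q.1 q.2 ∈ p.closedSpan (Icc 0 q.1) := by
    rw [← hqker, LinearMap.mem_ker]
    change p.adj (σ q.1 q.2) (φ₁ q.1 q.2 - φ₂ q.1 q.2) = 0
    rw [map_sub, hq, sub_self]
  obtain ⟨c, hc⟩ := WeightPair.exists_eq_smul_δ hmem (Submodule.sub_mem _ m₁ m₂)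
  -- The bond maturing at the current time has price 1, so the value of `c • δ_t` is `c` itself.
  have hδ : p.δ q.1 (p.incl (bondPrice P q.1 q.2)) = 1 := inv_mul_cancel₀ hqpos.ne'
  rw [hc, smul_apply, hδ, smul_eq_mul, mul_one] at hqval
  rw [hqval, zero_smul] at hc
  exact sub_eq_zero.1 hc
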